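/- Let $n\ge 1$, let $w_0=1$ and let $w_1,\dots,w_n$ be positive integers; put $\mu=w_0+\cdots+w_n$, $w^w=\prod_i w_i^{w_i}$ and $m_1=\prod_i w_i$. Let $U=(\mathbb C^*)^n$ with coordinates $u_1,\dots,u_n$, let $\mathcal M_B=\mathbb C^*$ with coordinate $x$, let $u_0=u_1^{-w_1}\cdots u_n^{-w_n}$ and $$F(u_1,\dots,u_n,x)=u_1+\cdots+u_n+x\,u_0 .$$ With $\theta=\tau^{-1}$, let $$G=\frac{\Omega^n(U)[x^{\pm1},\tau^{\pm1}]}{(d_u-\tau\, d_uF)\wedge\Omega^{n-1}(U)[x^{\pm1},\tau^{\pm1}]},\qquad G_0=\frac{\Omega^n(U)[x^{\pm1},\theta]}{(\theta\, d_u-d_uF)\wedge\Omega^{n-1}(U)[x^{\pm1},\theta]}$$ be the (Fourier–Laplace transformed) Gauss–Manin system and Brieskorn lattice of $F$, where $\Omega^p(U)$ denotes algebraic forms, and let $\nabla^B$ be the connection on $G$ given by $\nabla^B_{\partial_\tau}(\omega\tau^i)=i\omega\tau^{i-1}-F\omega\tau^i$ and $\nabla^B_{\partial_x}(\omega\tau^i)=\mathcal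 L_{\partial_x}(\omega)\tau^i-\frac{\partial F}{\partial x}\omega\tau^{i+1}$ for $\omega\in\Omega^n(U)[x^{\pm1}]$. Define $a(k)\in\mathbb N^{n+1}$ by $a(0)=0$ and $a(k+1)=a(k)+\mathbf 1_{i(k)}$, where $i(k)$ is the smallest index $i$ at which $a(k)_i/w_i$ is minimal. For $0\le k\le\mu-1$ let $\omega_k^\varphi\in G_0$ be the class of $$\frac{(xu_0)^{a(k)_0}u_1^{a(k)_1}\cdots u_n^{a(k)_n}}{w_1^{a(k)_1}\cdots w_n^{a(k)_n}}\;\frac{du_1}{u_1}\wedge\cdots\wedge\frac{du_n}{u_n}.$$ A Saito structure of weight $n$ on $\mathbb P^1\times M$, where $M$ is a complex manifold, is a tuple $(M,H,\nabla,S,n)$ in which $H$ is a trivial holomorphic vector bundle on $\mathbb P^1\times M$; $\nabla$ is a flat meromorphic connection on $H$, with poles only along $\{0,\infty\}\times M$, logarithmic along $\{\infty\}\times M$ and of order (Poincaré rank) at most one along $\{0\}\times M$; and $S:\mathcal H\times i^*\mathcal H\to z^n\mathcal O_{\mathbb P^1\times M}$ (where $\mathcal H$ is the sheaf of sections of $H$,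 $z$ is the coordinate on $\mathbb P^1\setminus\{\infty\}$ and $i(z,t)=(-z,t)$) is a $\nabla$-flat bilinear form such that $z^{-n}S$ is symmetric and is nondegenerate at every point of $\mathbb P^1\times M$. **Theorem.** The classes $\omega^\varphi_0,\dots,\omega^\varphi_{\mu-1}$ form a basis of $G_0$ over $\mathbb C[x^{\pm1},\theta]$, and their images in $G$ form a basis of $G$ over $\mathbb C[x^{\pm1},\theta^{\pm1}]$. Let $H^B$ be the trivial bundle on $\mathbb P^1\times\mathcal M_B$ (with coordinate $z=\theta$ on $\mathbb P^1\setminus\{\infty\}$) with global frame $\omega^\varphi_0,\dots,\omega^\varphi_{\mu-1}$, equipped with the meromorphic connection $\nabla^B$ whose matrix in this frame is the matrix of $\nabla^B$ in the basis $(\omega^\varphi_k)$ of $G$, and with the pairing $S^B$ determined by $$S^B(\omega_k^\varphi,\omega_\ell^\varphi)=\begin{cases} m_1^{-1}\theta^n & \text{if } 0\le k\le n \text{ and } k+\ell=n,\\ w^{-w}\,m_1^{-1}\,x\,\theta^n & \text{if } n+1\le k\le\mu-1 \text{ and } k+\ell=\mu+n,\\ 0&\text{otherwise}\end{cases}$$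 and by $a(x,\theta)S^B(\cdot,\cdot)=S^B(a(x,\theta)\cdot,\cdot)=S^B(\cdot,a(x,-\theta)\cdot)$. Then $(\mathcal M_B,H^B,\nabla^B,S^B,n)$ is a Saito structure of weight $n$ on $\mathbb P^1\times\mathbb C^*$. -/

import Mathlib

open scoped BigOperators

/-! ## Saito structures on `ℙ¹ × M`

`M` is an open subset of a finite-dimensional complex vector space `E`, `ℙ¹` is `OnePoint ℂ`, with
the coordinate `z` on `ℙ¹ ∖ {∞}` and the coordinate `τ = z⁻¹` on `ℙ¹ ∖ {0}`.  The trivial bundle `H`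
is `(ℙ¹ × M) × V`. -/

/-- The point of `ℙ¹` at which the coordinate `τ = z⁻¹` takes the given value. -/
noncomputable def pointOfTau (τ : ℂ) : OnePoint ℂ :=
  if τ = 0 then OnePoint.infty else ((τ⁻¹ : ℂ) : OnePoint ℂ)

/-- Holomorphic functions on `ℙ¹ × M`: holomorphic in both charts `ℂ × M`. -/
def IsHolomorphicOnP1 {E : Type*} [NormedAddCommGroup E] [NormedSpace ℂ E]
    (M : Set E) (f : OnePoint ℂ × E → ℂ) : Prop :=
  AnalyticOnNhd ℂ (fun p : ℂ × E => f ((p.1 : OnePoint ℂ), p.2)) (Set.univ ×ˢ M) ∧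
  AnalyticOnNhd ℂ (fun p : ℂ × E => f (pointOfTau p.1, p.2)) (Set.univ ×ˢ M)

/-- `(M, H, ∇, S, n)` is a Saito structure of weight `n`, where `H` is the trivial bundle with fibre
`V` on `ℙ¹ × M`.

* The connection is `∇ = d + conn`.  The `End V`-valued 1-form `conn` is given on `ℂ* × M`; the
  value `conn p X v` is `(∇_X v)(p)` for the constant section `v` and the tangent vector `X` at `p`.
* The pairing `pairing (z, t)` is the bilinear form `H_{(z,t)} × H_{(-z,t)} → ℂ`, for `z ≠ 0`. -/
structure IsSaitoStructure {E V : Type*} [NormedAddCommGroup E] [NormedSpace ℂ E]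
    [FiniteDimensional ℂ E] [NormedAddCommGroup V] [NormedSpace ℂ V] [FiniteDimensional ℂ V]
    (M : Set E) (conn : ℂ × E → (ℂ × E) →ₗ[ℂ] Module.End ℂ V)
    (pairing : ℂ × E → LinearMap.BilinForm ℂ V) (n : ℕ) : Prop where
  weight_pos : 0 < n
  isOpen_base : IsOpen M
  /-- The connection is holomorphic outside `{0, ∞} × M`. -/
  holomorphic : ∀ X v, AnalyticOnNhd ℂ (fun p => conn p X v) ({0}ᶜ ×ˢ M)
  /-- The curvature `dΩ + Ω ∧ Ω` of `∇ = d + Ω` vanishes. -/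
  flat : ∀ p ∈ ({0}ᶜ : Set ℂ) ×ˢ M, ∀ X Y v,
    fderiv ℂ (fun q => conn q Y v) p X - fderiv ℂ (fun q => conn q X v) p Y
      + conn p X (conn p Y v) - conn p Y (conn p X v) = 0
  /-- Pole of order (Poincaré rank) one along `{0} × M`: the form `z • Ω`, written in terms of
  `dz / z` and of differentials on `M`, extends holomorphically to `z = 0`. -/
  order_one_at_zero : ∃ g : ℂ × E → (ℂ × E) →ₗ[ℂ] Module.End ℂ V,
    (∀ X v, AnalyticOnNhd ℂ (fun p => g p X v) (Set.univ ×ˢ M)) ∧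
    ∀ z : ℂ, z ≠ 0 → ∀ t ∈ M, ∀ (a : ℂ) (ξ : E),
      g (z, t) (a, ξ) = z • conn (z, t) (z * a, ξ)
  /-- Logarithmic pole along `{∞} × M`: the form `Ω`, written in terms of `dτ / τ`, where `τ = z⁻¹`,
  and of differentials on `M`, extends holomorphically to `τ = 0`; note `τ ∂_τ = - z ∂_z`. -/
  logarithmic_at_infty : ∃ g : ℂ × E → (ℂ × E) →ₗ[ℂ] Module.End ℂ V,
    (∀ X v, AnalyticOnNhd ℂ (fun p => g p X v) (Set.univ ×ˢ M)) ∧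
    ∀ τ : ℂ, τ ≠ 0 → ∀ t ∈ M, ∀ (a : ℂ) (ξ : E),
      g (τ, t) (a, ξ) = conn (τ⁻¹, t) (-(τ⁻¹ * a), ξ)
  /-- The pairing takes holomorphic sections to `zⁿ 𝒪`, and `z⁻ⁿ S` is nondegenerate at every point
  of `ℙ¹ × M`. -/
  nondegenerate : ∃ g : OnePoint ℂ × E → LinearMap.BilinForm ℂ V,
    (∀ v v', IsHolomorphicOnP1 M (fun p => g p v v')) ∧
    (∀ p, p.2 ∈ M → (g p).Nondegenerate) ∧
    ∀ z : ℂ, z ≠ 0 → ∀ t ∈ M, pairing (z, t) = z ^ n • g ((z : OnePoint ℂ), t)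
  /-- `z⁻ⁿ S` is symmetric. -/
  symmetric : ∀ z : ℂ, z ≠ 0 → ∀ t ∈ M, ∀ v v',
    pairing (z, t) v v' = (-1) ^ n * pairing (-z, t) v' v
  /-- `X (S(v, v')) = S(∇_X v, v') + S(v, (i^*∇)_X v')`, where `i (z, t) = (-z, t)`. -/
  pairing_flat : ∀ z : ℂ, z ≠ 0 → ∀ t ∈ M, ∀ (a : ℂ) (ξ : E) (v v' : V),
    fderiv ℂ (fun q => pairing q v v') (z, t) (a, ξ) =
      pairing (z, t) (conn (z, t) (a, ξ) v) v' + pairing (z, t) v (conn (-z, t) (-a, ξ) v')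

/-! ## Combinatorics of the weights `w₀, …, wₙ` -/

/-- `μ = w₀ + ⋯ + wₙ`. -/
def weightSum {n : ℕ} (w : Fin (n + 1) → ℕ) : ℕ := ∑ i, w i

theorem exists_min_ratio {n : ℕ} (w a : Fin (n + 1) → ℕ) :
    (Finset.univ.filter fun i => ∀ j, (a i : ℚ) / w i ≤ (a j : ℚ) / w j).Nonempty := by
  obtain ⟨i, _, hi⟩ := Finset.exists_min_image (Finset.univ : Finset (Fin (n + 1)))
    (fun i => (a i : ℚ) / w i) ⟨0, Finset.mem_univ _⟩
  exact ⟨i, by simpa using hi⟩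

/-- The smallest index `i` at which `aᵢ / wᵢ` is minimal. -/
def minIndex {n : ℕ} (w a : Fin (n + 1) → ℕ) : Fin (n + 1) :=
  (Finset.univ.filter fun i => ∀ j, (a i : ℚ) / w i ≤ (a j : ℚ) / w j).min'
    (exists_min_ratio w a)

/-- The multi-indices `a(k)`: `a(0) = 0` and `a(k+1) = a(k) + 1_{i(k)}`, where `i(k)` is the smallest
index at which `a(k)ᵢ / wᵢ` is minimal. -/
def multiIndex {n : ℕ} (w : Fin (n + 1) → ℕ) : ℕ → Fin (n + 1) → ℕ
  | 0 => 0
  | k + 1 => multiIndex w k + Pi.single (minIndex w (multiIndex w k)) 1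

/-! ## Laurent polynomials and forms on the torus

`BaseRing ℤ = ℂ[x, x⁻¹, θ, θ⁻¹]` and `BaseRing ℕ = ℂ[x, x⁻¹, θ]`, where `θ = τ⁻¹`; likewise
`TotalRing n Θ` is the ring of Laurent polynomials in `u₁, …, uₙ` over `BaseRing Θ`.  The monomial
`u^r x^a θ^b` has exponent `(r, a, b)`. -/

abbrev BaseRing (Θ : Type) [AddCommMonoid Θ] : Type := AddMonoidAlgebra ℂ (ℤ × Θ)

abbrev TotalRing (n : ℕ) (Θ : Type) [AddCommMonoid Θ] : Type :=
  AddMonoidAlgebra ℂ ((Fin n → ℤ) × ℤ × Θ)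

noncomputable instance TotalRing.instAlgebra (n : ℕ) (Θ : Type) [AddCommMonoid Θ] :
    Algebra (BaseRing Θ) (TotalRing n Θ) :=
  (AddMonoidAlgebra.mapDomainRingHom ℂ
    (AddMonoidHom.inr (Fin n → ℤ) (ℤ × Θ))).toAlgebra

theorem TotalRing.algebraMap_single {n : ℕ} {Θ : Type} [AddCommMonoid Θ] (e : ℤ × Θ) (c : ℂ) :
    algebraMap (BaseRing Θ) (TotalRing n Θ) (AddMonoidAlgebra.single e c) =
      AddMonoidAlgebra.single (0, e) c := by
  change AddMonoidAlgebra.mapDomainRingHom ℂ _ _ = _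
  simp

instance TotalRing.instIsScalarTower (n : ℕ) (Θ : Type) [AddCommMonoid Θ] :
    IsScalarTower ℂ (BaseRing Θ) (TotalRing n Θ) :=
  IsScalarTower.of_algebraMap_eq fun c => by
    simp only [AddMonoidAlgebra.coe_algebraMap, Function.comp_apply]
    rw [TotalRing.algebraMap_single]
    rfl

/-- The Euler derivation attached to an additive function `l` of the exponent: it multiplies the
monomial of exponent `e` by `l e`. -/
noncomputable def eulerDer {S : Type} [AddCommMonoid S] (l : S →+ ℂ) :
    AddMonoidAlgebra ℂ S →ₗ[ℂ] AddMonoidAlgebra ℂ S where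
  toFun f := f.coeff.sum fun e c => AddMonoidAlgebra.single e (l e * c)
  map_add' f g := by
    rw [AddMonoidAlgebra.coeff_add, Finsupp.sum_add_index'] <;>
      simp [mul_add, AddMonoidAlgebra.single_add]
  map_smul' c f := by
    rw [AddMonoidAlgebra.coeff_smul, Finsupp.sum_smul_index' (by simp), RingHom.id_apply,
      Finsupp.smul_sum]
    simp only [AddMonoidAlgebra.smul_single, smul_eq_mul]
    congr 1
    ext e d : 2
    congr 1
    ring

theorem eulerDer_single {S : Type} [AddCommMonoid S] (l : S →+ ℂ) (e : S) (c : ℂ) :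
    eulerDer l (AddMonoidAlgebra.single e c) = AddMonoidAlgebra.single e (l e * c) := by
  simp [eulerDer]

theorem eulerDer_mul {S : Type} [AddCommMonoid S] (l : S →+ ℂ) (f g : AddMonoidAlgebra ℂ S) :
    eulerDer l (f * g) = eulerDer l f * g + f * eulerDer l g := by
  induction f using AddMonoidAlgebra.induction_linear with
  | zero => simp
  | add f₁ f₂ h₁ h₂ => simp only [add_mul, map_add, h₁, h₂]; ring
  | single e c =>
    induction g using AddMonoidAlgebra.induction_linear with
    | zero => simp
    | add g₁ g₂ h₁ h₂ => simp only [mul_add, map_add, h₁, h₂]; ring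
    | single e' c' =>
      simp only [eulerDer_single, AddMonoidAlgebra.single_mul_single, map_add,
        ← AddMonoidAlgebra.single_add]
      congr 1
      ring

theorem eulerDer_comm {S : Type} [AddCommMonoid S] (l l' : S →+ ℂ) (f : AddMonoidAlgebra ℂ S) :
    eulerDer l (eulerDer l' f) = eulerDer l' (eulerDer l f) := by
  induction f using AddMonoidAlgebra.induction_linear with
  | zero => simp
  | add f₁ f₂ h₁ h₂ => simp only [map_add, h₁, h₂]
  | single e c => simp only [eulerDer_single]; congr 1; ring

/-- The exponent function of the derivation `∑ vᵢ uᵢ ∂/∂uᵢ`. -/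
noncomputable def uChar {n : ℕ} {Θ : Type} [AddCommMonoid Θ] (v : Fin n → ℂ) :
    (Fin n → ℤ) × ℤ × Θ →+ ℂ where
  toFun e := ∑ i, v i * (e.1 i : ℂ)
  map_zero' := by simp
  map_add' e e' := by simp [mul_add, Finset.sum_add_distrib]

/-- The invariant vector field `∑ vᵢ uᵢ ∂/∂uᵢ` on the torus `U`. -/
noncomputable def uDer (n : ℕ) (Θ : Type) [AddCommMonoid Θ] (v : Fin n → ℂ) :
    TotalRing n Θ →ₗ[ℂ] TotalRing n Θ :=
  eulerDer (uChar v)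

/-- The derivation `x ∂/∂x`. -/
noncomputable def xDer (n : ℕ) (Θ : Type) [AddCommMonoid Θ] :
    TotalRing n Θ →ₗ[ℂ] TotalRing n Θ :=
  eulerDer
    { toFun := fun e => (e.2.1 : ℂ)
      map_zero' := by simp
      map_add' := fun e e' => by simp }

/-- The derivation `τ ∂/∂τ`; recall `θ = τ⁻¹`. -/
noncomputable def tauDer (n : ℕ) : TotalRing n ℤ →ₗ[ℂ] TotalRing n ℤ :=
  eulerDer
    { toFun := fun e => -(e.2.2 : ℂ)
      map_zero' := by simp
      map_add' := fun e e' => by simp; ring }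

/-- The monomial `u_{i+1}` (indices of `Fin n` start at `0`). -/
noncomputable def uMon {n : ℕ} (Θ : Type) [AddCommMonoid Θ] (i : Fin n) : TotalRing n Θ :=
  AddMonoidAlgebra.single (Pi.single i 1, 0, 0) 1

/-- The monomial `x u₀ = x / (u₁^{w₁} ⋯ uₙ^{wₙ})`. -/
noncomputable def xuZero {n : ℕ} (Θ : Type) [AddCommMonoid Θ] (w : Fin (n + 1) → ℕ) :
    TotalRing n Θ :=
  AddMonoidAlgebra.single (fun i => -(w i.succ : ℤ), 1, 0) 1

/-- The Laurent polynomial `F = u₁ + ⋯ + uₙ + x / (u₁^{w₁} ⋯ uₙ^{wₙ})`. -/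
noncomputable def potential {n : ℕ} (Θ : Type) [AddCommMonoid Θ] (w : Fin (n + 1) → ℕ) :
    TotalRing n Θ :=
  ∑ i, uMon Θ i + xuZero Θ w

/-- The algebraic differential forms of degree `p` on the torus `U = (ℂ*)ⁿ`, with coefficients
extended to `BaseRing Θ`.  The vector fields `uᵢ ∂/∂uᵢ` are a basis of the derivations of `ℂ[U]`, so
that a `p`-form is the same as an alternating `ℂ`-multilinear map on their `ℂ`-span `ℂⁿ` with values
in `TotalRing n Θ`. -/
abbrev TorusForm (n : ℕ) (Θ : Type) [AddCommMonoid Θ] (p : ℕ) : Type :=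
  (Fin n → ℂ) [⋀^Fin p]→ₗ[ℂ] TotalRing n Θ

/-- The operator `a ∂_v - b ∂_v(F)` on `TotalRing n Θ`, for `v = ∑ vᵢ uᵢ ∂/∂uᵢ`. -/
noncomputable def twistedDer {n : ℕ} {Θ : Type} [AddCommMonoid Θ] (w : Fin (n + 1) → ℕ)
    (a b : BaseRing Θ) (v : Fin n → ℂ) : TotalRing n Θ →ₗ[BaseRing Θ] TotalRing n Θ where
  toFun f := a • uDer n Θ v f - b • (uDer n Θ v (potential Θ w) * f)
  map_add' f g := by simp only [map_add, mul_add, smul_add]; abel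
  map_smul' c f := by
    have h : uDer n Θ v (algebraMap (BaseRing Θ) (TotalRing n Θ) c) = 0 := by
      induction c using AddMonoidAlgebra.induction_linear with
      | zero => simp
      | add c₁ c₂ h₁ h₂ => simp only [map_add, h₁, h₂, add_zero]
      | single e r =>
        rw [TotalRing.algebraMap_single, uDer, eulerDer_single]
        simp [uChar]
    have h' : uDer n Θ v (c • f) = c • uDer n Θ v f := by
      rw [Algebra.smul_def, Algebra.smul_def, uDer, eulerDer_mul]
      rw [uDer] at h
      rw [h, zero_mul, zero_add]
    rw [h', RingHom.id_apply, smul_sub, smul_comm a c, mul_smul_comm, smul_comm b c]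

theorem uDer_add {n : ℕ} {Θ : Type} [AddCommMonoid Θ] (v v' : Fin n → ℂ) (f : TotalRing n Θ) :
    uDer n Θ (v + v') f = uDer n Θ v f + uDer n Θ v' f := by
  induction f using AddMonoidAlgebra.induction_linear with
  | zero => simp
  | add f₁ f₂ h₁ h₂ => simp only [map_add, h₁, h₂]; abel
  | single e r =>
    simp only [uDer, eulerDer_single, ← AddMonoidAlgebra.single_add]
    congr 1
    simp [uChar, add_mul, Finset.sum_add_distrib]

theorem uDer_smul {n : ℕ} {Θ : Type} [AddCommMonoid Θ] (c : ℂ) (v : Fin n → ℂ)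
    (f : TotalRing n Θ) : uDer n Θ (c • v) f = c • uDer n Θ v f := by
  induction f using AddMonoidAlgebra.induction_linear with
  | zero => simp
  | add f₁ f₂ h₁ h₂ => simp only [map_add, h₁, h₂, smul_add]
  | single e r =>
    simp only [uDer, eulerDer_single, AddMonoidAlgebra.smul_single]
    congr 1
    simp [uChar, Finset.mul_sum, Finset.sum_mul, mul_assoc]

instance TorusForm.instIsScalarTower (n : ℕ) (Θ : Type) [AddCommMonoid Θ] (p : ℕ) :
    IsScalarTower ℂ (BaseRing Θ) (TorusForm n Θ p) :=
  ⟨fun c b η => by ext y : 1; exact smul_assoc c b (η y)⟩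

/-- The twisted differential `η ↦ a d_u η - b d_u F ∧ η` on `p`-forms. On forms seen as alternating
maps on commuting vector fields, `d` and `dF ∧` are given by alternating sums:
`(d η)(v₀, …, v_p) = ∑ (-1)ⁱ ∂_{vᵢ} (η(v₀, …, v̂ᵢ, …, v_p))` and
`(dF ∧ η)(v₀, …, v_p) = ∑ (-1)ⁱ ∂_{vᵢ}(F) η(v₀, …, v̂ᵢ, …, v_p)`. -/
noncomputable def twistedDiff {n : ℕ} {Θ : Type} [AddCommMonoid Θ] (w : Fin (n + 1) → ℕ)
    (a b : BaseRing Θ) (p : ℕ) : TorusForm n Θ p →ₗ[BaseRing Θ] TorusForm n Θ (p + 1) where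
  toFun η := AlternatingMap.alternatizeUncurryFin
    { toFun := fun v => ((twistedDer w a b v).restrictScalars ℂ).compAlternatingMap η
      map_add' := fun v v' => by
        ext y : 1
        simp only [twistedDer, LinearMap.compAlternatingMap_apply, AlternatingMap.add_apply,
          LinearMap.restrictScalars_apply, LinearMap.coe_mk, AddHom.coe_mk, uDer_add, add_mul,
          smul_add]
        abel
      map_smul' := fun c v => by
        ext y : 1
        simp only [twistedDer, LinearMap.compAlternatingMap_apply, AlternatingMap.smul_apply,
          LinearMap.restrictScalars_apply, LinearMap.coe_mk, AddHom.coe_mk, uDer_smul,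
          smul_mul_assoc, RingHom.id_apply, smul_sub, smul_comm _ c] }
  map_add' η η' := by
    ext y : 1
    simp [AlternatingMap.alternatizeUncurryFin_apply, Finset.sum_add_distrib]
  map_smul' c η := by
    ext y : 1
    simp only [AlternatingMap.alternatizeUncurryFin_apply, LinearMap.coe_mk, AddHom.coe_mk,
      LinearMap.compAlternatingMap_apply, AlternatingMap.smul_apply,
      LinearMap.restrictScalars_apply, map_smul, RingHom.id_apply, Finset.smul_sum,
      smul_comm _ c]

theorem twistedDiff_apply {n : ℕ} {Θ : Type} [AddCommMonoid Θ] (w : Fin (n + 1) → ℕ)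
    (a b : BaseRing Θ) (p : ℕ) (η : TorusForm n Θ p) (y : Fin (p + 1) → Fin n → ℂ) :
    twistedDiff w a b p η y =
      ∑ i : Fin (p + 1), (-1) ^ (i : ℕ) • twistedDer w a b (y i) (η (i.removeNth y)) := by
  simp [twistedDiff, AlternatingMap.alternatizeUncurryFin_apply]

/-! ## The Gauss-Manin system and the Brieskorn lattice, for `n = m + 1` -/

/-- `θ` in `ℂ[x, x⁻¹, θ, θ⁻¹]` or in `ℂ[x, x⁻¹, θ]`. -/
noncomputable def theta (Θ : Type) [AddCommMonoidWithOne Θ] : BaseRing Θ :=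
  AddMonoidAlgebra.single (0, 1) 1

/-- `τ = θ⁻¹` in `ℂ[x, x⁻¹, θ, θ⁻¹]`. -/
noncomputable def tau : BaseRing ℤ := AddMonoidAlgebra.single (0, -1) 1

/-- `x⁻¹` in `ℂ[x, x⁻¹, θ, θ⁻¹]`. -/
noncomputable def xInv : BaseRing ℤ := AddMonoidAlgebra.single (-1, 0) 1

/-- `(d_u - τ d_u F) ∧ Ω^{n-1}(U)[x, x⁻¹, τ, τ⁻¹]`. -/
noncomputable def gaussManinRelations {m : ℕ} (w : Fin (m + 2) → ℕ) :
    Submodule (BaseRing ℤ) (TorusForm (m + 1) ℤ (m + 1)) :=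
  LinearMap.range (twistedDiff w 1 tau m)

/-- The Gauss-Manin system `G` of `F`. -/
abbrev GaussManin {m : ℕ} (w : Fin (m + 2) → ℕ) : Type :=
  TorusForm (m + 1) ℤ (m + 1) ⧸ gaussManinRelations w

/-- `(τ⁻¹ d_u - d_u F) ∧ Ω^{n-1}(U)[x, x⁻¹, τ⁻¹]`. -/
noncomputable def brieskornRelations {m : ℕ} (w : Fin (m + 2) → ℕ) :
    Submodule (BaseRing ℕ) (TorusForm (m + 1) ℕ (m + 1)) :=
  LinearMap.range (twistedDiff w (theta ℕ) 1 m)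

/-- The Brieskorn lattice `G₀` of `F`. -/
abbrev BrieskornLattice {m : ℕ} (w : Fin (m + 2) → ℕ) : Type :=
  TorusForm (m + 1) ℕ (m + 1) ⧸ brieskornRelations w

/-- The operator `∂_τ - F` on coefficients. -/
noncomputable def tauOp {m : ℕ} (w : Fin (m + 2) → ℕ) :
    TotalRing (m + 1) ℤ →ₗ[ℂ] TotalRing (m + 1) ℤ where
  toFun f := theta ℤ • tauDer (m + 1) f - potential ℤ w * f
  map_add' f g := by simp only [map_add, mul_add, smul_add]; abel
  map_smul' c f := by
    simp only [map_smul, mul_smul_comm, RingHom.id_apply, smul_sub, smul_comm c]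

/-- The operator `∂_x - τ ∂F/∂x` on coefficients. -/
noncomputable def xOp {m : ℕ} (w : Fin (m + 2) → ℕ) :
    TotalRing (m + 1) ℤ →ₗ[ℂ] TotalRing (m + 1) ℤ where
  toFun f := xInv • xDer (m + 1) ℤ f
    - tau • ((xInv • xDer (m + 1) ℤ (potential ℤ w)) * f)
  map_add' f g := by simp only [map_add, mul_add, smul_add]; abel
  map_smul' c f := by
    simp only [map_smul, mul_smul_comm, RingHom.id_apply, smul_sub, smul_comm c]

theorem tauOp_comm {m : ℕ} (w : Fin (m + 2) → ℕ) (v : Fin (m + 1) → ℂ)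
    (f : TotalRing (m + 1) ℤ) :
    tauOp w (twistedDer w 1 tau v f) = twistedDer w 1 tau v (tauOp w f) := by
  have h1 : algebraMap (BaseRing ℤ) (TotalRing (m + 1) ℤ) (theta ℤ) *
      algebraMap (BaseRing ℤ) (TotalRing (m + 1) ℤ) tau = 1 := by
    rw [← map_mul, theta, tau, AddMonoidAlgebra.single_mul_single]
    norm_num
    exact map_one _
  have h2 : tauDer (m + 1) (algebraMap (BaseRing ℤ) (TotalRing (m + 1) ℤ) tau) =
      algebraMap (BaseRing ℤ) (TotalRing (m + 1) ℤ) tau := by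
    rw [tau, TotalRing.algebraMap_single, tauDer, eulerDer_single]
    simp
  have h3 : uDer (m + 1) ℤ v (algebraMap (BaseRing ℤ) (TotalRing (m + 1) ℤ) (theta ℤ)) = 0 := by
    rw [theta, TotalRing.algebraMap_single, uDer, eulerDer_single]
    simp [uChar]
  have h4 : tauDer (m + 1) (potential ℤ w) = 0 := by
    simp [potential, uMon, xuZero, tauDer, eulerDer_single]
  have h5 : tauDer (m + 1) (uDer (m + 1) ℤ v (potential ℤ w)) = 0 := by
    have := eulerDer_comm (uChar v) _ (potential ℤ w) |>.symm.trans
      (congrArg (uDer (m + 1) ℤ v) h4)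
    rw [map_zero] at this
    exact this
  have h6 : tauDer (m + 1) (uDer (m + 1) ℤ v f) = uDer (m + 1) ℤ v (tauDer (m + 1) f) :=
    eulerDer_comm _ _ f
  have L : ∀ g h, tauDer (m + 1) (g * h) = tauDer (m + 1) g * h + g * tauDer (m + 1) h :=
    eulerDer_mul _
  have L' : ∀ g h, uDer (m + 1) ℤ v (g * h) =
      uDer (m + 1) ℤ v g * h + g * uDer (m + 1) ℤ v h := eulerDer_mul _
  simp only [tauOp, twistedDer, LinearMap.coe_mk, AddHom.coe_mk, Algebra.smul_def, map_sub, L, L',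
    h2, h3, h5, h6, map_one, one_mul]
  linear_combination (-(uDer (m + 1) ℤ v (potential ℤ w)) * f) * h1

theorem xOp_comm {m : ℕ} (w : Fin (m + 2) → ℕ) (v : Fin (m + 1) → ℂ)
    (f : TotalRing (m + 1) ℤ) :
    xOp w (twistedDer w 1 tau v f) = twistedDer w 1 tau v (xOp w f) := by
  have h2 : xDer (m + 1) ℤ (algebraMap (BaseRing ℤ) (TotalRing (m + 1) ℤ) tau) = 0 := by
    rw [tau, TotalRing.algebraMap_single, xDer, eulerDer_single]
    simp
  have h3 : uDer (m + 1) ℤ v (algebraMap (BaseRing ℤ) (TotalRing (m + 1) ℤ) tau) = 0 := by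
    rw [tau, TotalRing.algebraMap_single, uDer, eulerDer_single]
    simp [uChar]
  have h4 : uDer (m + 1) ℤ v (algebraMap (BaseRing ℤ) (TotalRing (m + 1) ℤ) xInv) = 0 := by
    rw [xInv, TotalRing.algebraMap_single, uDer, eulerDer_single]
    simp [uChar]
  have h6 : ∀ g, xDer (m + 1) ℤ (uDer (m + 1) ℤ v g) = uDer (m + 1) ℤ v (xDer (m + 1) ℤ g) :=
    fun g => eulerDer_comm _ _ g
  have L : ∀ g h, xDer (m + 1) ℤ (g * h) = xDer (m + 1) ℤ g * h + g * xDer (m + 1) ℤ h :=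
    eulerDer_mul _
  have L' : ∀ g h, uDer (m + 1) ℤ v (g * h) =
      uDer (m + 1) ℤ v g * h + g * uDer (m + 1) ℤ v h := eulerDer_mul _
  simp only [xOp, twistedDer, LinearMap.coe_mk, AddHom.coe_mk, Algebra.smul_def, map_sub, L, L',
    h2, h3, h4, h6, map_one, one_mul]
  ring

/-- An operator on coefficients commuting with the operators `∂_v - τ ∂_v F` acts on `G`. -/
noncomputable def gaussManinLift {m : ℕ} (w : Fin (m + 2) → ℕ)
    (D : TotalRing (m + 1) ℤ →ₗ[ℂ] TotalRing (m + 1) ℤ)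
    (hD : ∀ v f, D (twistedDer w 1 tau v f) = twistedDer w 1 tau v (D f)) :
    GaussManin w →ₗ[ℂ] GaussManin w :=
  ((gaussManinRelations w).restrictScalars ℂ).mapQ ((gaussManinRelations w).restrictScalars ℂ)
    { toFun := fun η => D.compAlternatingMap η
      map_add' := fun η η' => by ext y : 1; simp
      map_smul' := fun c η => by ext y : 1; simp } <| by
    rintro _ ⟨η, rfl⟩
    refine ⟨D.compAlternatingMap η, ?_⟩
    ext y : 1
    change twistedDiff w 1 tau m _ y = D (twistedDiff w 1 tau m η y)
    simp only [twistedDiff_apply, map_sum, map_zsmul, hD]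
    rfl

/-- The connection `∇_{∂_τ}` on `G`: `∇_{∂_τ}(ω τⁱ) = i ω τ^{i-1} - F ω τⁱ`. -/
noncomputable def nablaTau {m : ℕ} (w : Fin (m + 2) → ℕ) : GaussManin w →ₗ[ℂ] GaussManin w :=
  gaussManinLift w (tauOp w) (tauOp_comm w)

/-- The connection `∇_{∂_x}` on `G`: `∇_{∂_x}(ω τⁱ) = ℒ_{∂_x}(ω) τⁱ - (∂F/∂x) ω τ^{i+1}`. -/
noncomputable def nablaX {m : ℕ} (w : Fin (m + 2) → ℕ) : GaussManin w →ₗ[ℂ] GaussManin w :=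
  gaussManinLift w (xOp w) (xOp_comm w)

/-- The connection in the variable `θ = τ⁻¹`: `∇_{∂_θ} = -τ² ∇_{∂_τ}`. -/
noncomputable def nablaTheta {m : ℕ} (w : Fin (m + 2) → ℕ) (η : GaussManin w) : GaussManin w :=
  -(tau ^ 2 • nablaTau w η)

/-- The inclusion `ℂ[u, u⁻¹, x, x⁻¹, θ] → ℂ[u, u⁻¹, x, x⁻¹, θ, θ⁻¹]`. -/
noncomputable def coeffIncl (n : ℕ) : TotalRing n ℕ →ₐ[ℂ] TotalRing n ℤ :=
  AddMonoidAlgebra.mapDomainAlgHom ℂ ℂ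
    ((AddMonoidHom.id (Fin n → ℤ)).prodMap
      ((AddMonoidHom.id ℤ).prodMap (Nat.castAddMonoidHom ℤ)))

theorem coeffIncl_single (n : ℕ) (r : Fin n → ℤ) (a : ℤ) (b : ℕ) (c : ℂ) :
    coeffIncl n (AddMonoidAlgebra.single (r, a, b) c) =
      AddMonoidAlgebra.single (r, a, (b : ℤ)) c := by
  simp [coeffIncl]

theorem coeffIncl_twistedDer {m : ℕ} (w : Fin (m + 2) → ℕ) (v : Fin (m + 1) → ℂ)
    (f : TotalRing (m + 1) ℕ) :
    coeffIncl (m + 1) (twistedDer w (theta ℕ) 1 v f) =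
      twistedDer w 1 tau v (theta ℤ • coeffIncl (m + 1) f) := by
  have h1 : ∀ g, coeffIncl (m + 1) (uDer (m + 1) ℕ v g) =
      uDer (m + 1) ℤ v (coeffIncl (m + 1) g) := by
    intro g
    induction g using AddMonoidAlgebra.induction_linear with
    | zero => simp
    | add g₁ g₂ h₁ h₂ => simp only [map_add, h₁, h₂]
    | single e c =>
      obtain ⟨r, a, b⟩ := e
      simp only [uDer, eulerDer_single, coeffIncl_single]
      rfl
  have h2 : coeffIncl (m + 1) (potential ℕ w) = potential ℤ w := by
    simp [potential, uMon, xuZero, coeffIncl_single]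
  have h3 : coeffIncl (m + 1) (algebraMap (BaseRing ℕ) (TotalRing (m + 1) ℕ) (theta ℕ)) =
      algebraMap (BaseRing ℤ) (TotalRing (m + 1) ℤ) (theta ℤ) := by
    simp [theta, TotalRing.algebraMap_single, coeffIncl_single]
  have h4 : algebraMap (BaseRing ℤ) (TotalRing (m + 1) ℤ) tau *
      algebraMap (BaseRing ℤ) (TotalRing (m + 1) ℤ) (theta ℤ) = 1 := by
    rw [← map_mul, theta, tau, AddMonoidAlgebra.single_mul_single]
    norm_num
    exact map_one _
  rw [map_smul]
  simp only [twistedDer, LinearMap.coe_mk, AddHom.coe_mk, Algebra.smul_def, map_sub, map_mul, h1,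
    h2, h3, map_one, one_mul]
  linear_combination ((uDer (m + 1) ℤ v (potential ℤ w)) * coeffIncl (m + 1) f) * h4

/-- The canonical map `G₀ → G`. -/
noncomputable def toGaussManin {m : ℕ} (w : Fin (m + 2) → ℕ) :
    BrieskornLattice w →ₗ[ℂ] GaussManin w :=
  ((brieskornRelations w).restrictScalars ℂ).mapQ ((gaussManinRelations w).restrictScalars ℂ)
    { toFun := fun η => (coeffIncl (m + 1)).toLinearMap.compAlternatingMap η
      map_add' := fun η η' => by ext y : 1; simp
      map_smul' := fun c η => by ext y : 1; simp } <| by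
    rintro _ ⟨η, rfl⟩
    refine ⟨theta ℤ • (coeffIncl (m + 1)).toLinearMap.compAlternatingMap η, ?_⟩
    ext y : 1
    change twistedDiff w 1 tau m _ y = coeffIncl (m + 1) (twistedDiff w (theta ℕ) 1 m η y)
    simp only [twistedDiff_apply, map_sum, map_zsmul, coeffIncl_twistedDer]
    rfl

/-! ## The canonical basis, the bundle `H^B` and the pairing `S^B` -/

/-- The form `f (du₁/u₁) ∧ ⋯ ∧ (duₙ/uₙ)`. -/
noncomputable def logVolume {n : ℕ} {Θ : Type} [AddCommMonoid Θ] (f : TotalRing n Θ) :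
    TorusForm n Θ n :=
  (LinearMap.toSpanSingleton ℂ (TotalRing n Θ) f).compAlternatingMap (Pi.basisFun ℂ (Fin n)).det

/-- The class `ω_k` in `G₀` of
`(x u₀)^{a(k)₀} u₁^{a(k)₁} ⋯ uₙ^{a(k)ₙ} / (w₁^{a(k)₁} ⋯ wₙ^{a(k)ₙ}) (du₁/u₁) ∧ ⋯ ∧ (duₙ/uₙ)`;
when `w₀ = 1`, one has `a(0)₀ = 0` and `a(k)₀ = 1` for `1 ≤ k ≤ μ - 1`. -/
noncomputable def omegaPhi {m : ℕ} (w : Fin (m + 2) → ℕ) (k : ℕ) : BrieskornLattice w :=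
  (brieskornRelations w).mkQ <| logVolume <|
    ((∏ i : Fin (m + 1), (w i.succ : ℂ) ^ multiIndex w k i.succ)⁻¹) •
      (xuZero ℕ w ^ multiIndex w k 0 * ∏ i : Fin (m + 1), uMon ℕ i ^ multiIndex w k i.succ)

/-- The value at `(θ, x) = (z, t)` of an element of `ℂ[x, x⁻¹, θ, θ⁻¹]`. -/
noncomputable def evalBase (p : ℂ × ℂ) (f : BaseRing ℤ) : ℂ :=
  f.coeff.sum fun e c => c * p.2 ^ e.1 * p.1 ^ e.2

/-- The connection form of `∇` in a basis `b` of `G`, as a 1-form on `ℂ* × ℂ*` in the coordinates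
`(θ, x)`: the bundle is trivialised by `b`, and the coordinates of `∇_{∂_θ} b_j` and `∇_{∂_x} b_j` in
the basis `b` are the `j`-th columns of the matrices of the connection. -/
noncomputable def connectionForm {m : ℕ} (w : Fin (m + 2) → ℕ) {r : ℕ}
    (b : Module.Basis (Fin r) (BaseRing ℤ) (GaussManin w)) (p : ℂ × ℂ) :
    (ℂ × ℂ) →ₗ[ℂ] Module.End ℂ (Fin r → ℂ) :=
  (LinearMap.fst ℂ ℂ ℂ).smulRight
      (Matrix.toLin' (Matrix.of fun i j => evalBase p (b.repr (nablaTheta w (b j)) i))) +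
    (LinearMap.snd ℂ ℂ ℂ).smulRight
      (Matrix.toLin' (Matrix.of fun i j => evalBase p (b.repr (nablaX w (b j)) i)))

/-- The matrix `S^B(ω_k, ω_ℓ)`, with `n = m + 1`. Here `∏ wᵢ` and `∏ wᵢ^{wᵢ}` are `m₁` and `w^w`. -/
noncomputable def gramMatrix {m : ℕ} (w : Fin (m + 2) → ℕ) (k l : ℕ) : BaseRing ℤ :=
  if k ≤ m + 1 ∧ k + l = m + 1 then
    AddMonoidAlgebra.single (0, (m : ℤ) + 1) (∏ i, (w i : ℂ))⁻¹
  else if m + 2 ≤ k ∧ k + l = weightSum w + (m + 1) then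
    AddMonoidAlgebra.single (1, (m : ℤ) + 1) ((∏ i, (w i : ℂ) ^ w i) * ∏ i, (w i : ℂ))⁻¹
  else 0

/-- The pairing `S^B` on the trivial bundle with frame `ω_0, …, ω_{μ-1}`. -/
noncomputable def pairingB {m : ℕ} (w : Fin (m + 2) → ℕ) (p : ℂ × ℂ) :
    LinearMap.BilinForm ℂ (Fin (weightSum w) → ℂ) :=
  Matrix.toBilin' (Matrix.of fun k l => evalBase p (gramMatrix w k l))

/-! Put `n = m + 1`, write `X^s = (x u₀)^{s₀} u₁^{s₁} ⋯ uₙ^{sₙ}` for `s ∈ ℤ^{n+1}`, and let `Δ = x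
u₀ - θ x ∂_x`, which is `-θ ∇_{x∂_x}`. The proof rests on one relation between classes, symmetric in
`i = 0, …, n`: `[X^{s + 1_i}] = w_i [Δ X^s] + θ s_i [X^s]`. With `r_k = a(k)_i / w_i` for `i =
i(k)`, it reads `Δ ω_k = ω_{k+1} - θ r_k ω_k` along the path `a(k)`. Since `a(μ) = w`, and `X^{s+w}
= x X^s` because `w₀ = 1`, the path closes up: `ω_μ = w^{-w} x ω_0`.

Generation: the span of the `ω_k` is stable under `Δ`, hence under every step of the lattice
(`span_frame`). Independence: on a free module of rank `μ`, define `Δ` by the formulas above. The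
steps `w_i Δ + θ s_i` commute and are compatible with multiplication by `x`, so they define a
function on `ℤ^{n+1}` (`exists_int_walk`, `exists_model_walk`), that is, a linear map which kills
the relations and takes the `ω_k` to the standard basis (`exists_model_map`). Both arguments treat
`G₀` and `G` at once.

Connection: `F` is the sum of the coordinates `x u₀, u₁, …, uₙ`, and `∑ w_i = μ`, `∑ a(k)_i = k`. So
the connection form is `(dx/x - μ dθ/θ)(A - C/θ) + D dθ/θ`, with `A = diag(r_k)`, `D = diag(k)`, `C
: ω_k ↦ ω_{k+1}` (`connectionForm_gaussManinBasis`). The poles can be read off, and flatness is the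
homogeneity of `C` with respect to `D`. The pairing is flat because `C` is self-adjoint and `k + l`,
`r_k + r_l` are constant on each of the two antidiagonals (`IsSaitoStructure.of_modelConnection`).
The arithmetic input is that `r_k + r_l` is `0` on the first and `1` on the second: the `r_k` are
the fractions `j / w_i`, `0 ≤ j < w_i`, in increasing order; `n + 1` of them are zero and the others
are symmetric under `q ↦ 1 - q` (`minRatio_add_minRatio`). -/

/-! ## The multi-indices `a(k)` -/

/-- The minimal ratio `a(k)ᵢ / wᵢ`. -/
def minRatio {n : ℕ} (w : Fin (n + 1) → ℕ) (k : ℕ) : ℚ :=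
  (multiIndex w k (minIndex w (multiIndex w k)) : ℚ) / w (minIndex w (multiIndex w k))

theorem minIndex_spec {n : ℕ} (w a : Fin (n + 1) → ℕ) (j : Fin (n + 1)) :
    (a (minIndex w a) : ℚ) / w (minIndex w a) ≤ (a j : ℚ) / w j := by
  have h := Finset.min'_mem _ (exists_min_ratio w a)
  rw [Finset.mem_filter] at h
  exact h.2 j

theorem multiIndex_succ {n : ℕ} (w : Fin (n + 1) → ℕ) (k : ℕ) :
    multiIndex w (k + 1) = multiIndex w k + Pi.single (minIndex w (multiIndex w k)) 1 := rfl

theorem sum_multiIndex {n : ℕ} (w : Fin (n + 1) → ℕ) (k : ℕ) : ∑ i, multiIndex w k i = k := by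
  induction k with
  | zero => simp [multiIndex]
  | succ k ih => simp [multiIndex_succ, Finset.sum_add_distrib, ih]

/-- A coordinate can exceed `w_i` only by a step at which the minimal ratio is at least `1`; then
`a(k)_j ≥ w_j` for all `j`, and `k = ∑ a(k)_j ≥ μ`. -/
theorem multiIndex_le {n : ℕ} {w : Fin (n + 1) → ℕ} (hw : ∀ i, 0 < w i) {k : ℕ}
    (hk : k ≤ weightSum w) (i : Fin (n + 1)) : multiIndex w k i ≤ w i := by
  induction k generalizing i with
  | zero => simp [multiIndex]
  | succ k ih =>
    have ih' := ih (by omega)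
    rw [multiIndex_succ, Pi.add_apply]
    by_cases hi : i = minIndex w (multiIndex w k)
    · subst hi
      rw [Pi.single_eq_same, Nat.add_one_le_iff]
      by_contra hlt
      obtain ⟨j, -, hj⟩ : ∃ j ∈ Finset.univ, multiIndex w k j < w j := by
        apply Finset.exists_lt_of_sum_lt
        rw [sum_multiIndex]
        exact hk
      have h := minIndex_spec w (multiIndex w k) j
      have hw' : ∀ i, (0 : ℚ) < w i := fun i => by exact_mod_cast hw i
      rw [div_le_div_iff₀ (hw' _) (hw' _)] at h
      have h1 : multiIndex w k (minIndex w (multiIndex w k)) * w j ≤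
          multiIndex w k j * w (minIndex w (multiIndex w k)) := by exact_mod_cast h
      have h2 : w (minIndex w (multiIndex w k)) * w j ≤
          multiIndex w k (minIndex w (multiIndex w k)) * w j :=
        Nat.mul_le_mul_right _ (not_lt.mp hlt)
      have h3 := Nat.mul_lt_mul_of_pos_right hj (hw (minIndex w (multiIndex w k)))
      rw [mul_comm (w j)] at h3
      omega
    · rw [Pi.single_eq_of_ne hi, add_zero]
      exact ih' i

/-- Both sides of the inequalities of `multiIndex_le` have sum `μ`, so each is an equality. -/
theorem multiIndex_weightSum {n : ℕ} {w : Fin (n + 1) → ℕ} (hw : ∀ i, 0 < w i) :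
    multiIndex w (weightSum w) = w := by
  funext i
  exact (Finset.sum_eq_sum_iff_of_le fun i _ => multiIndex_le hw le_rfl i).mp
    (sum_multiIndex w _) i (Finset.mem_univ i)

theorem succ_le_weightSum {n : ℕ} {w : Fin (n + 1) → ℕ} (hw : ∀ i, 0 < w i) :
    n + 1 ≤ weightSum w := by
  simpa [weightSum] using Finset.card_nsmul_le_sum Finset.univ w 1 fun i _ => hw i

/-! ### Symmetry of the minimal ratios -/

theorem minRatio_monotone {n : ℕ} (w : Fin (n + 1) → ℕ) : Monotone (minRatio w) := by
  refine monotone_nat_of_le_succ fun k =>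
    (minIndex_spec w (multiIndex w k) (minIndex w (multiIndex w (k + 1)))).trans ?_
  rw [minRatio, multiIndex_succ]
  gcongr
  exact Nat.le_add_right _ _

/-- The `n + 1` entries of `a(k)` have sum `k < n + 1`, so one of them is zero. -/
theorem minRatio_eq_zero {n : ℕ} (w : Fin (n + 1) → ℕ) {k : ℕ} (hk : k ≤ n) :
    minRatio w k = 0 := by
  obtain ⟨j, hj⟩ : ∃ j, multiIndex w k j = 0 := by
    by_contra! h
    have := Finset.card_nsmul_le_sum Finset.univ (multiIndex w k) 1
      fun i _ => Nat.one_le_iff_ne_zero.mpr (h i)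
    rw [sum_multiIndex] at this
    simp at this
    omega
  have h := minIndex_spec w (multiIndex w k) j
  rw [hj, Nat.cast_zero, zero_div] at h
  exact le_antisymm h (by unfold minRatio; positivity)

/-- Step `k` records the ratio of the coordinate `i(k)` just before raising it by one, so coordinate
`i` has contributed `j / w_i` for each `j` below its current value. -/
theorem map_minRatio_range {n : ℕ} (w : Fin (n + 1) → ℕ) (K : ℕ) :
    (Multiset.range K).map (minRatio w) =
      ∑ i, (Multiset.range (multiIndex w K i)).map fun j : ℕ => (j : ℚ) / w i := by
  induction K with
  | zero => simp [multiIndex]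
  | succ K ih =>
    have h : ∀ i, (Multiset.range (multiIndex w (K + 1) i)).map (fun j : ℕ => (j : ℚ) / w i) =
        (Multiset.range (multiIndex w K i)).map (fun j : ℕ => (j : ℚ) / w i) +
          if i = minIndex w (multiIndex w K) then {minRatio w K} else 0 := by
      intro i
      rw [multiIndex_succ, Pi.add_apply]
      by_cases hi : i = minIndex w (multiIndex w K)
      · subst hi
        rw [Pi.single_eq_same, Multiset.range_succ, Multiset.map_cons, if_pos rfl,
          ← Multiset.singleton_add, add_comm]
        rfl
      · rw [Pi.single_eq_of_ne hi, if_neg hi, add_zero, add_zero]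
    rw [Finset.sum_congr rfl fun i _ => h i, Finset.sum_add_distrib, ← ih,
      Finset.sum_ite_eq' Finset.univ _ fun _ => ({minRatio w K} : Multiset ℚ)]
    simp [Multiset.range_succ, ← Multiset.singleton_add, add_comm]

theorem Multiset.range_add_one_eq_zero_cons (N : ℕ) :
    Multiset.range (N + 1) = 0 ::ₘ (Multiset.range N).map (· + 1) := by
  have := List.range_succ_eq_map (n := N)
  simp only [Multiset.range, this, ← Multiset.cons_coe, Multiset.map_coe]

/-- The `n + 1` zeros cancel: on one side they are the terms with `k ≤ n`, on the other the terms
with `j = 0`. -/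
theorem map_minRatio_range_tail {n : ℕ} {w : Fin (n + 1) → ℕ} (hw : ∀ i, 0 < w i) :
    (Multiset.range (weightSum w - (n + 1))).map (fun k => minRatio w (n + 1 + k)) =
      ∑ i, (Multiset.range (w i - 1)).map fun j : ℕ => ((j : ℚ) + 1) / w i := by
  have h := map_minRatio_range w (weightSum w)
  rw [multiIndex_weightSum hw] at h
  have hμ := succ_le_weightSum hw
  obtain ⟨N, hN⟩ := Nat.exists_eq_add_of_le hμ
  have h1 : (Multiset.range (weightSum w)).map (minRatio w) = Multiset.replicate (n + 1) 0 +
      (Multiset.range (weightSum w - (n + 1))).map (fun k => minRatio w (n + 1 + k)) := by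
    rw [hN, Nat.add_sub_cancel_left, Multiset.range_add, Multiset.map_add, Multiset.map_map]
    congr 1
    rw [Multiset.map_congr rfl (g := fun _ => (0 : ℚ)), Multiset.map_const', Multiset.card_range]
    intro k hk
    exact minRatio_eq_zero w (by rw [Multiset.mem_range] at hk; omega)
  have h2 : ∀ i, (Multiset.range (w i)).map (fun j : ℕ => (j : ℚ) / w i) =
      {0} + (Multiset.range (w i - 1)).map fun j : ℕ => ((j : ℚ) + 1) / w i := by
    intro i
    obtain ⟨v, hv⟩ := Nat.exists_eq_add_of_le' (hw i)
    generalize (w i : ℚ) = q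
    rw [hv, Multiset.range_add_one_eq_zero_cons, Multiset.map_cons, Multiset.map_map]
    simp
  have h3 : ∑ _i : Fin (n + 1), ({0} : Multiset ℚ) = Multiset.replicate (n + 1) 0 := by
    simp [Multiset.nsmul_singleton]
  rw [h1, Finset.sum_congr rfl fun i _ => h2 i, Finset.sum_add_distrib, h3] at h
  exact add_left_cancel h

theorem Multiset.map_range_reflect {α : Type*} (f : ℕ → α) (N : ℕ) :
    (Multiset.range N).map (fun k => f (N - 1 - k)) = (Multiset.range N).map f := by
  have h := congrArg (fun m => Multiset.map f m)
    (congrArg Finset.val (Finset.range_image_pred_top_sub N))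
  rw [Finset.image_val_of_injOn] at h
  · simpa [Multiset.map_map] using h
  · intro a ha b hb hab
    simp at ha hb hab
    omega

/-- Both `f` and `k ↦ c - f (N - 1 - k)` enumerate the same multiset in increasing order, and such
an enumeration is unique. -/
theorem add_reflect_eq_of_map_range_eq {f : ℕ → ℚ} (hf : Monotone f) {N : ℕ} {c : ℚ}
    (h : (Multiset.range N).map (fun k => c - f k) = (Multiset.range N).map f) {k : ℕ}
    (hk : k < N) : f k + f (N - 1 - k) = c := by
  have h1 : ((List.range N).map f).Pairwise (· ≤ ·) := by
    rw [List.pairwise_map]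
    exact List.pairwise_lt_range.imp fun hab => hf hab.le
  have h2 : ((List.range N).map fun k => c - f (N - 1 - k)).Pairwise (· ≤ ·) := by
    rw [List.pairwise_map]
    exact List.pairwise_lt_range.imp fun hab => sub_le_sub_left (hf (by omega)) _
  have h3 : ((List.range N).map fun k => c - f (N - 1 - k)).Perm ((List.range N).map f) := by
    rw [← Multiset.coe_eq_coe]
    exact (Multiset.map_range_reflect (fun k => c - f k) N).trans h
  have h4 := congrArg (fun l => l[k]?) (h3.eq_of_pairwise' h2 h1)
  simp [hk] at h4
  linarith

/-- The sequence of the nonzero ratios is symmetric under `q ↦ 1 - q`. -/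
theorem minRatio_add_minRatio {n : ℕ} {w : Fin (n + 1) → ℕ} (hw : ∀ i, 0 < w i) {k l : ℕ}
    (hk : n + 1 ≤ k) (hl : n + 1 ≤ l) (hkl : k + l = weightSum w + n) :
    minRatio w k + minRatio w l = 1 := by
  have hT := map_minRatio_range_tail hw
  have hR : (Multiset.range (weightSum w - (n + 1))).map (fun k => 1 - minRatio w (n + 1 + k)) =
      (Multiset.range (weightSum w - (n + 1))).map (fun k => minRatio w (n + 1 + k)) := by
    have h := congrArg (Multiset.map fun q : ℚ => 1 - q) hT
    rw [Multiset.map_map, ← Multiset.coe_mapAddMonoidHom (fun q : ℚ => 1 - q), map_sum] at h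
    refine h.trans (Eq.trans ?_ hT.symm)
    -- For a single weight, `j ↦ w_i - 2 - j` exchanges `(j + 1) / w_i` and `1 - (j + 1) / w_i`; the
    -- subtraction in `ℕ` is exact since `j < w_i - 1`.
    refine Finset.sum_congr rfl fun i _ => ?_
    rw [Multiset.coe_mapAddMonoidHom, Multiset.map_map,
      ← Multiset.map_range_reflect fun j : ℕ => ((j : ℚ) + 1) / w i]
    refine Multiset.map_congr rfl fun j hj => ?_
    rw [Multiset.mem_range] at hj
    have hwi : (w i : ℚ) ≠ 0 := by exact_mod_cast (hw i).ne'
    have : ((w i - 1 - 1 - j : ℕ) : ℚ) = w i - 1 - 1 - j := by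
      rw [Nat.cast_sub (by omega), Nat.cast_sub (by omega), Nat.cast_sub (hw i), Nat.cast_one]
    simp only [Function.comp_apply, this]
    field_simp
    ring
  have h := add_reflect_eq_of_map_range_eq (f := fun k => minRatio w (n + 1 + k))
    (fun a b hab => minRatio_monotone w (by omega)) hR (k := k - (n + 1)) (by omega)
  convert h using 3 <;> omega

/-! ## A criterion for Saito structures over the punctured line -/

theorem hasFDerivAt_zpow_mul_zpow (i j : ℤ) {p : ℂ × ℂ} (h1 : p.1 ≠ 0) (h2 : p.2 ≠ 0) :
    HasFDerivAt (fun q : ℂ × ℂ => q.1 ^ i * q.2 ^ j)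
      ((i * p.1 ^ (i - 1) * p.2 ^ j) • ContinuousLinearMap.fst ℂ ℂ ℂ +
        (j * p.1 ^ i * p.2 ^ (j - 1)) • ContinuousLinearMap.snd ℂ ℂ ℂ) p := by
  have e1 := (hasDerivAt_zpow i p.1 (Or.inl h1)).comp_hasFDerivAt p
    (hasFDerivAt_fst (𝕜 := ℂ) (E := ℂ) (F := ℂ))
  have e2 := (hasDerivAt_zpow j p.2 (Or.inl h2)).comp_hasFDerivAt p
    (hasFDerivAt_snd (𝕜 := ℂ) (E := ℂ) (F := ℂ))
  refine (e1.mul e2).congr_fderiv ?_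
  ext <;> simp <;> ring

/-- The connection form `(ξ/t - μ a/z) (A - (C₀ + t C₁)/z) + (a/z) D`, at the point `(z, t)` and the
tangent vector `(a, ξ)`. -/
noncomputable def modelConnection {V : Type*} [AddCommGroup V] [Module ℂ V] (μ : ℂ)
    (C₀ C₁ A D : Module.End ℂ V) (p X : ℂ × ℂ) : Module.End ℂ V :=
  (X.2 * p.2⁻¹ - μ * (X.1 * p.1⁻¹)) • (A - p.1⁻¹ • (C₀ + p.2 • C₁)) + (X.1 * p.1⁻¹) • D

section criterion

variable {V : Type*} [NormedAddCommGroup V] [NormedSpace ℂ V]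

theorem analyticAt_modelConnection (μ : ℂ) (C₀ C₁ A D : Module.End ℂ V) (X : ℂ × ℂ) (v : V)
    {p : ℂ × ℂ} (h1 : p.1 ≠ 0) (h2 : p.2 ≠ 0) :
    AnalyticAt ℂ (fun q => modelConnection μ C₀ C₁ A D q X v) p := by
  simp only [modelConnection, LinearMap.add_apply, LinearMap.smul_apply, LinearMap.sub_apply]
  have a1 : AnalyticAt ℂ (fun q : ℂ × ℂ => q.1⁻¹) p := analyticAt_fst.inv h1
  have a2 : AnalyticAt ℂ (fun q : ℂ × ℂ => q.2⁻¹) p := analyticAt_snd.inv h2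
  have a3 : AnalyticAt ℂ (fun q : ℂ × ℂ => q.2) p := analyticAt_snd
  fun_prop

/-- Sorting by monomials `z^i t^j` with constant coefficients allows differentiation term by term.
-/
theorem modelConnection_eq (μ : ℂ) (C₀ C₁ A D : Module.End ℂ V) (p X : ℂ × ℂ) (v : V)
    (h1 : p.1 ≠ 0) (h2 : p.2 ≠ 0) :
    modelConnection μ C₀ C₁ A D p X v =
      (p.1 ^ (0 : ℤ) * p.2 ^ (-1 : ℤ)) • X.2 • A v
      + (p.1 ^ (-1 : ℤ) * p.2 ^ (0 : ℤ)) • ((X.1 • D v - (μ * X.1) • A v) - X.2 • C₁ v)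
      - (p.1 ^ (-1 : ℤ) * p.2 ^ (-1 : ℤ)) • X.2 • C₀ v
      + (p.1 ^ (-2 : ℤ) * p.2 ^ (0 : ℤ)) • (μ * X.1) • C₀ v
      + (p.1 ^ (-2 : ℤ) * p.2 ^ (1 : ℤ)) • (μ * X.1) • C₁ v := by
  have e1 : p.1 ^ (-2 : ℤ) = p.1⁻¹ * p.1⁻¹ := by
    rw [zpow_neg, ← mul_inv, zpow_ofNat, sq]
  simp only [modelConnection, LinearMap.add_apply, LinearMap.smul_apply, LinearMap.sub_apply, e1,
    zpow_neg_one, zpow_zero, zpow_one]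
  match_scalars <;> field_simp <;> ring

theorem fderiv_modelConnection (μ : ℂ) (C₀ C₁ A D : Module.End ℂ V) (p X Y : ℂ × ℂ) (v : V)
    (h1 : p.1 ≠ 0) (h2 : p.2 ≠ 0) :
    fderiv ℂ (fun q => modelConnection μ C₀ C₁ A D q Y v) p X =
      (-X.2 * p.2⁻¹ ^ 2) • Y.2 • A v
      - (X.1 * p.1⁻¹ ^ 2) • ((Y.1 • D v - (μ * Y.1) • A v) - Y.2 • C₁ v)
      + (X.1 * p.1⁻¹ ^ 2 * p.2⁻¹ + X.2 * p.1⁻¹ * p.2⁻¹ ^ 2) • Y.2 • C₀ v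
      - (2 * X.1 * p.1⁻¹ ^ 3) • (μ * Y.1) • C₀ v
      + (X.2 * p.1⁻¹ ^ 2 - 2 * X.1 * p.1⁻¹ ^ 3 * p.2) • (μ * Y.1) • C₁ v := by
  have ho : IsOpen {q : ℂ × ℂ | q.1 ≠ 0 ∧ q.2 ≠ 0} :=
    (isOpen_ne.preimage continuous_fst).inter (isOpen_ne.preimage continuous_snd)
  have hev : (fun q => modelConnection μ C₀ C₁ A D q Y v) =ᶠ[nhds p] _ :=
    Filter.eventually_of_mem (ho.mem_nhds ⟨h1, h2⟩)
      fun q hq => modelConnection_eq μ C₀ C₁ A D q Y v hq.1 hq.2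
  have H := fun (i j : ℤ) (u : V) => (hasFDerivAt_zpow_mul_zpow i j h1 h2).smul_const u
  have H' := ((((H 0 (-1) (Y.2 • A v)).add
    (H (-1) 0 ((Y.1 • D v - (μ * Y.1) • A v) - Y.2 • C₁ v))).sub
    (H (-1) (-1) (Y.2 • C₀ v))).add (H (-2) 0 ((μ * Y.1) • C₀ v))).add
    (H (-2) 1 ((μ * Y.1) • C₁ v))
  rw [hev.fderiv_eq]
  refine (congrArg (fun L => L X) H'.fderiv).trans ?_
  norm_num [add_apply, sub_apply]
  module

end criterion

/-- A trivial bundle on `ℙ¹ × ℂ*` with a connection and a pairing of the indicated form is a Saito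
structure. -/
theorem IsSaitoStructure.of_modelConnection {V : Type*} [NormedAddCommGroup V] [NormedSpace ℂ V]
    [FiniteDimensional ℂ V] {n : ℕ} (hn : 0 < n) (μ : ℂ) (C₀ C₁ A D : Module.End ℂ V)
    (g₀ g₁ : LinearMap.BilinForm ℂ V)
    {conn : ℂ × ℂ → (ℂ × ℂ) →ₗ[ℂ] Module.End ℂ V} {pairing : ℂ × ℂ → LinearMap.BilinForm ℂ V}
    (hconn : ∀ z t : ℂ, z ≠ 0 → t ≠ 0 → ∀ X,
      conn (z, t) X = modelConnection μ C₀ C₁ A D (z, t) X)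
    (hpairing : ∀ z t : ℂ, z ≠ 0 → t ≠ 0 → pairing (z, t) = z ^ n • (g₀ + t • g₁))
    (hAD : ∀ v, A (D v) = D (A v)) (hC₀ : ∀ v, C₀ (D v) - D (C₀ v) = -C₀ v)
    (hC₁ : ∀ v, C₁ (D v) - D (C₁ v) = (μ - 1) • C₁ v)
    (hnd : ∀ t : ℂ, t ≠ 0 → (g₀ + t • g₁).Nondegenerate)
    (hs₀ : ∀ v v', g₀ v v' = g₀ v' v) (hs₁ : ∀ v v', g₁ v v' = g₁ v' v)
    (hC : ∀ (t : ℂ) (v v' : V), (g₀ + t • g₁) ((C₀ + t • C₁) v) v' =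
      (g₀ + t • g₁) v ((C₀ + t • C₁) v'))
    (hA₀ : ∀ v v', g₀ (A v) v' + g₀ v (A v') = 0)
    (hA₁ : ∀ v v', g₁ (A v) v' + g₁ v (A v') = g₁ v v')
    (hD₀ : ∀ v v', g₀ (D v) v' + g₀ v (D v') = n * g₀ v v')
    (hD₁ : ∀ v v', g₁ (D v) v' + g₁ v (D v') = (n + μ) * g₁ v v') :
    IsSaitoStructure ({0}ᶜ : Set ℂ) conn pairing n where
  weight_pos := hn
  isOpen_base := isOpen_compl_singleton
  holomorphic X v := by
    have ho : IsOpen (({0}ᶜ : Set ℂ) ×ˢ ({0}ᶜ : Set ℂ)) :=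
      isOpen_compl_singleton.prod isOpen_compl_singleton
    refine AnalyticOnNhd.congr ho
      (fun p hp => analyticAt_modelConnection μ C₀ C₁ A D X v hp.1 hp.2) ?_
    intro p hp
    simp only [hconn _ _ hp.1 hp.2]
  -- Write `Ω = η B + (dz/z) D` with `η = dt/t - μ dz/z` closed and `B = A - C/z`. As `η ∧ η = 0`,
  -- no commutator of `A` and `C` occurs; what remains is `(z ∂_z + μ t ∂_t) B = [B, D]`, which is
  -- the content of `hAD`, `hC₀` and `hC₁`.
  flat := by
    intro p hp X Y v
    have ho : IsOpen (({0}ᶜ : Set ℂ) ×ˢ ({0}ᶜ : Set ℂ)) :=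
      isOpen_compl_singleton.prod isOpen_compl_singleton
    have hev : ∀ Z, (fun q => conn q Z v) =ᶠ[nhds p]
        fun q => modelConnection μ C₀ C₁ A D q Z v := fun Z =>
      Filter.eventually_of_mem (ho.mem_nhds hp) fun q hq => by
        simp only [hconn _ _ hq.1 hq.2]
    have h1 : p.1 ≠ 0 := hp.1
    have h2 : p.2 ≠ 0 := hp.2
    rw [(hev Y).fderiv_eq, (hev X).fderiv_eq, hconn _ _ h1 h2, hconn _ _ h1 h2,
      fderiv_modelConnection _ _ _ _ _ _ _ _ _ h1 h2,
      fderiv_modelConnection _ _ _ _ _ _ _ _ _ h1 h2]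
    have hC₀' : C₀ (D v) = D (C₀ v) - C₀ v := by
      rw [sub_eq_add_neg, ← hC₀ v]; abel
    have hC₁' : C₁ (D v) = D (C₁ v) + (μ - 1) • C₁ v := by
      rw [← hC₁ v]; abel
    simp only [modelConnection, LinearMap.add_apply, LinearMap.smul_apply, LinearMap.sub_apply,
      map_add, map_sub, map_smul, hAD, hC₀', hC₁']
    match_scalars <;> field_simp <;> ring
  -- Writing `dz` as `z · dz/z` removes the pole of `a/z`, and the factor `z` absorbs that of `C/z`.
  order_one_at_zero := by
    refine ⟨fun p =>
      { toFun := fun X => (X.2 * p.2⁻¹ - μ * X.1) • (p.1 • A - (C₀ + p.2 • C₁)) + (p.1 * X.1) • D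
        map_add' := fun X Y => by simp only [Prod.fst_add, Prod.snd_add]; module
        map_smul' := fun c X => by
          simp only [Prod.smul_fst, Prod.smul_snd, RingHom.id_apply, smul_eq_mul]; module },
      ?_, ?_⟩
    · intro X v p hp
      have a2 : AnalyticAt ℂ (fun q : ℂ × ℂ => q.2⁻¹) p := analyticAt_snd.inv hp.2
      have a1 : AnalyticAt ℂ (fun q : ℂ × ℂ => q.1) p := analyticAt_fst
      have a3 : AnalyticAt ℂ (fun q : ℂ × ℂ => q.2) p := analyticAt_snd
      simp only [LinearMap.coe_mk, AddHom.coe_mk, LinearMap.add_apply, LinearMap.smul_apply,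
        LinearMap.sub_apply]
      fun_prop
    · intro z hz t ht a ξ
      have ht' : t ≠ 0 := ht
      rw [hconn _ _ hz ht]
      simp only [LinearMap.coe_mk, AddHom.coe_mk, modelConnection]
      match_scalars <;> field_simp
  -- In the chart at infinity `C/z` is `τ C`, and `dz/z = -dτ/τ` reverses the signs of `μ` and `D`.
  logarithmic_at_infty := by
    refine ⟨fun p =>
      { toFun := fun X => (X.2 * p.2⁻¹ + μ * X.1) • (A - p.1 • (C₀ + p.2 • C₁)) - X.1 • D
        map_add' := fun X Y => by simp only [Prod.fst_add, Prod.snd_add]; module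
        map_smul' := fun c X => by
          simp only [Prod.smul_fst, Prod.smul_snd, RingHom.id_apply, smul_eq_mul]; module },
      ?_, ?_⟩
    · intro X v p hp
      have a2 : AnalyticAt ℂ (fun q : ℂ × ℂ => q.2⁻¹) p := analyticAt_snd.inv hp.2
      have a1 : AnalyticAt ℂ (fun q : ℂ × ℂ => q.1) p := analyticAt_fst
      have a3 : AnalyticAt ℂ (fun q : ℂ × ℂ => q.2) p := analyticAt_snd
      simp only [LinearMap.coe_mk, AddHom.coe_mk, LinearMap.add_apply, LinearMap.smul_apply,
        LinearMap.sub_apply]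
      fun_prop
    · intro z hz t ht a ξ
      have ht' : t ≠ 0 := ht
      rw [hconn _ _ (inv_ne_zero hz) ht]
      simp only [LinearMap.coe_mk, AddHom.coe_mk, modelConnection]
      match_scalars <;> field_simp <;> ring
  nondegenerate := by
    -- The form `z⁻ⁿ S` does not depend on `z`, so it extends to `0` and `∞` as it stands.
    refine ⟨fun p => g₀ + p.2 • g₁, fun v v' => ?_, fun p hp => hnd _ hp,
      fun z hz t ht => hpairing _ _ hz ht⟩
    have : ∀ s : Set (ℂ × ℂ), AnalyticOnNhd ℂ (fun p : ℂ × ℂ => (g₀ + p.2 • g₁) v v') s := by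
      intro s p _
      have a3 : AnalyticAt ℂ (fun q : ℂ × ℂ => q.2) p := analyticAt_snd
      simp only [LinearMap.add_apply, LinearMap.smul_apply]
      fun_prop
    exact ⟨this _, this _⟩
  symmetric := by
    intro z hz t ht v v'
    have hsq : ((-1 : ℂ) ^ n) * (-1) ^ n = 1 := by rw [← mul_pow]; norm_num
    rw [hpairing _ _ hz ht, hpairing _ _ (neg_ne_zero.mpr hz) ht]
    simp only [LinearMap.add_apply, LinearMap.smul_apply, smul_eq_mul, hs₀ v' v, hs₁ v' v]
    rw [neg_pow]
    linear_combination (-(z ^ n * (g₀ v v' + t * g₁ v v'))) * hsq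
  pairing_flat := by
    intro z hz t ht a ξ v v'
    have ht' : t ≠ 0 := ht
    have ho : IsOpen (({0}ᶜ : Set ℂ) ×ˢ ({0}ᶜ : Set ℂ)) :=
      isOpen_compl_singleton.prod isOpen_compl_singleton
    have hev : (fun q => pairing q v v') =ᶠ[nhds (z, t)]
        fun q => (q.1 ^ (n : ℤ) * q.2 ^ (0 : ℤ)) • g₀ v v' +
          (q.1 ^ (n : ℤ) * q.2 ^ (1 : ℤ)) • g₁ v v' :=
      Filter.eventually_of_mem (ho.mem_nhds ⟨hz, ht⟩) fun q hq => by
        simp only [hpairing _ _ hq.1 hq.2, LinearMap.add_apply, LinearMap.smul_apply, smul_eq_mul,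
          zpow_natCast, zpow_zero, zpow_one]
        ring
    have H := fun (i j : ℤ) (u : ℂ) =>
      (hasFDerivAt_zpow_mul_zpow i j (p := (z, t)) hz ht).smul_const u
    rw [hev.fderiv_eq]
    refine (congrArg (fun L => L (a, ξ)) ((H n 0 (g₀ v v')).add (H n 1 (g₁ v v'))).fderiv).trans ?_
    have hz' : z ^ ((n : ℤ) - 1) = z ^ n * z⁻¹ := by
      rw [zpow_sub_one₀ hz, zpow_natCast]
    rw [hpairing _ _ hz ht, hconn _ _ hz ht, hconn _ _ (neg_ne_zero.mpr hz) ht]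
    have c := hC t v v'
    have d₀ := hD₀ v v'
    have d₁ := hD₁ v v'
    have a₀ := hA₀ v v'
    have a₁ := hA₁ v v'
    simp only [modelConnection, LinearMap.add_apply, LinearMap.smul_apply, LinearMap.sub_apply,
      map_add, map_sub, map_smul, smul_eq_mul, inv_neg] at c ⊢
    simp only [add_apply, ContinuousLinearMap.smulRight_apply, smul_apply,
      ContinuousLinearMap.coe_fst', ContinuousLinearMap.coe_snd', hz', zpow_natCast, zpow_zero,
      zpow_one, smul_eq_mul, sub_self, Int.cast_natCast, Int.cast_zero, Int.cast_one]
    -- Pulling back by `i` keeps `dz/z` and changes the sign of `C/z`, so the self-adjoint `C` drops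
    -- out. The terms in `A` give `(ξ/t - μ a/z) t g₁`, those in `D` give `(a/z)(n g₀ + (n + μ) t
    -- g₁)`, and `μ` cancels.
    linear_combination (-(z ^ n * (ξ * t⁻¹ - μ * (a * z⁻¹)))) * (a₀ + t * a₁ - z⁻¹ * c) -
      z ^ n * a * z⁻¹ * (d₀ + t * d₁) - z ^ n * ξ * g₁ v v' * inv_mul_cancel₀ ht'

/-! ## Functions on lattices with prescribed difference equations -/

/-- The directions are walked in a fixed order; since distinct directions commute, the step equation
then holds in each of them. -/
theorem exists_nat_walk {V : Type*} {n : ℕ} (T : Fin n → ℕ → V → V)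
    (hT : ∀ i j, i ≠ j → ∀ a b v, T i a (T j b v) = T j b (T i a v)) (v₀ : V) :
    ∃ φ : (Fin n → ℕ) → V, φ 0 = v₀ ∧ ∀ s i, φ (s + Pi.single i 1) = T i (s i) (φ s) := by
  induction n with
  | zero => exact ⟨fun _ => v₀, rfl, fun _ i => i.elim0⟩
  | succ n ih =>
    obtain ⟨φ, h0, hφ⟩ := ih (fun i => T i.succ)
      fun i j hij => hT _ _ fun h => hij (Fin.succ_injective _ h)
    -- Direction `0` is walked last: `s 0` steps of `T 0` from the value of the lower-dimensional
    -- walk.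
    refine ⟨fun s => Nat.rec (φ fun i => s i.succ) (fun a v => T 0 a v) (s 0), h0, fun s i => ?_⟩
    refine Fin.cases ?_ (fun i => ?_) i
    · simp only [Pi.add_apply, Pi.single_eq_same, ne_eq, Fin.succ_ne_zero, not_false_eq_true,
        Pi.single_eq_of_ne, add_zero]
    · have h1 : (fun j : Fin n => (s + Pi.single i.succ 1 : Fin (n + 1) → ℕ) j.succ) =
          (fun j => s j.succ) + Pi.single i 1 := by
        funext j
        by_cases hj : j = i
        · subst hj; simp
        · simp [hj]
      have h2 : (s + Pi.single i.succ 1 : Fin (n + 1) → ℕ) 0 = s 0 := by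
        simp [(Fin.succ_ne_zero i).symm]
      simp only [h1, h2, hφ]
      induction s 0 with
      | zero => rfl
      | succ a ih => simp only [ih, hT 0 i.succ (Fin.succ_ne_zero i).symm]

theorem exists_toNat_translate {n : ℕ} {w : Fin n → ℕ} (hw : ∀ i, 0 < w i) (s : Fin n → ℤ) :
    ∃ N : ℕ, ∀ i, 0 ≤ s i + N * w i := by
  refine ⟨∑ i, (s i).natAbs, fun i => ?_⟩
  have h1 : (s i).natAbs ≤ ∑ i, (s i).natAbs :=
    Finset.single_le_sum (f := fun i => (s i).natAbs) (fun _ _ => Nat.zero_le _) (Finset.mem_univ i)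
  have h2 : (s i).natAbs ≤ (∑ i, (s i).natAbs) * w i := h1.trans (Nat.le_mul_of_pos_right _ (hw i))
  zify at h2
  have := neg_abs_le (s i)
  push_cast
  linarith

theorem nat_lattice_induction {n : ℕ} {P : (Fin n → ℕ) → Prop} (h0 : P 0)
    (hstep : ∀ s i, P s → P (s + Pi.single i 1)) (s : Fin n → ℕ) : P s := by
  induction hs : ∑ i, s i generalizing s with
  | zero =>
    have : s = 0 := by
      funext i
      exact (Finset.sum_eq_zero_iff.mp hs) i (Finset.mem_univ i)
    rwa [this]
  | succ N ih =>
    obtain ⟨i, -, hi⟩ : ∃ i ∈ Finset.univ, s i ≠ 0 :=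
      Finset.exists_ne_zero_of_sum_ne_zero (by omega)
    have hle : Pi.single i 1 ≤ s := by
      intro j
      by_cases hj : j = i
      · subst hj; simpa using Nat.one_le_iff_ne_zero.mpr hi
      · simp [hj]
    have hd : s - Pi.single i 1 + Pi.single i 1 = s := tsub_add_cancel_of_le hle
    rw [← hd]
    refine hstep _ _ (ih _ ?_)
    rw [← hd] at hs
    simp only [Pi.add_apply, Finset.sum_add_distrib, Finset.sum_pi_single', Finset.mem_univ,
      if_true] at hs
    omega

/-- Steps reach all of `ℕⁿ`; any integer vector lands there after enough translations by `w`, and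
the last hypothesis undoes these. -/
theorem int_lattice_induction {n : ℕ} {w : Fin n → ℕ} (hw : ∀ i, 0 < w i)
    {P : (Fin n → ℤ) → Prop} (h0 : P 0) (hstep : ∀ s i, P s → P (s + Pi.single i 1))
    (hw' : ∀ s, P (s + fun i => (w i : ℤ)) → P s) (s : Fin n → ℤ) : P s := by
  have hnat : ∀ s : Fin n → ℕ, P fun i => (s i : ℤ) := by
    refine nat_lattice_induction (by simpa [← Pi.zero_def] using h0) fun s i h => ?_
    convert hstep _ i h using 1
    funext j
    by_cases hj : j = i
    · subst hj; simp
    · simp [hj]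
  obtain ⟨N, hN⟩ := exists_toNat_translate hw s
  have hP : P (s + fun i => (N * w i : ℤ)) := by
    convert hnat fun i => (s i + N * w i).toNat using 1
    funext i
    simp [Int.toNat_of_nonneg (hN i)]
  clear hN
  induction N with
  | zero =>
    convert hP using 1
    funext i
    simp
  | succ N ih =>
    refine ih (hw' _ ?_)
    convert hP using 1
    funext i
    simp
    ring

/-- The `T i` need not be invertible, but `X` is: `φ s` is taken to be `X⁻ᴹ φ (s + M w)` for any `M`
with `s + M w ≥ 0`. Independence of `M` is the identity `φ (s + w) = X (φ s)`, which `hw'` gives at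
`0` and `hX` propagates. -/
theorem exists_int_walk {V : Type*} {n : ℕ} {w : Fin n → ℕ} (hw : ∀ i, 0 < w i)
    (T : Fin n → ℤ → V → V) (X : V ≃ V)
    (hT : ∀ i j, i ≠ j → ∀ a b v, T i a (T j b v) = T j b (T i a v))
    (hX : ∀ i a v, T i (a + w i) (X v) = X (T i a v)) (v₀ : V)
    (hw' : ∀ φ : (Fin n → ℕ) → V, φ 0 = v₀ →
      (∀ s i, φ (s + Pi.single i 1) = T i (s i) (φ s)) → φ w = X v₀) :
    ∃ φ : (Fin n → ℤ) → V, φ 0 = v₀ ∧ (∀ s i, φ (s + Pi.single i 1) = T i (s i) (φ s)) ∧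
      ∀ s, φ (s + fun i => (w i : ℤ)) = X (φ s) := by
  obtain ⟨φ, h0, hφ⟩ := exists_nat_walk (fun i a => T i a) (fun i j hij a b => hT i j hij a b) v₀
  have hφw : ∀ s, φ (s + w) = X (φ s) := by
    refine nat_lattice_induction ?_ fun s i h => ?_
    · rw [zero_add, h0, hw' φ h0 hφ]
    · rw [add_right_comm, hφ, h, hφ, ← hX]
      simp
  choose N hN using exists_toNat_translate hw
  set ψ : ℕ → (Fin n → ℤ) → V := fun M s => X.symm^[M] (φ fun i => (s i + M * w i).toNat) with hψ
  have hψs : ∀ (M : ℕ) (s : Fin n → ℤ), (∀ i, 0 ≤ s i + M * w i) → ψ (M + 1) s = ψ M s := by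
    intro M s h
    have : (fun i => (s i + (M + 1 : ℕ) * w i).toNat) = (fun i => (s i + M * w i).toNat) + w := by
      funext i
      have := h i
      have e : s i + ((M + 1 : ℕ) : ℤ) * w i = s i + M * w i + w i := by push_cast; ring
      rw [Pi.add_apply, e]
      omega
    simp only [hψ, this, hφw, Function.iterate_succ_apply, Equiv.symm_apply_apply]
  have hψk : ∀ (M k : ℕ) (s : Fin n → ℤ), (∀ i, 0 ≤ s i + M * w i) → ψ (M + k) s = ψ M s := by
    intro M k s h
    induction k with
    | zero => rfl
    | succ k ih =>
      rw [← add_assoc, hψs _ _ fun i => (h i).trans ?_, ih]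
      have : (0 : ℤ) ≤ (k : ℤ) * w i := by positivity
      push_cast
      linarith
  have hψN : ∀ (M : ℕ) (s : Fin n → ℤ), (∀ i, 0 ≤ s i + M * w i) → ψ (N s) s = ψ M s :=
      fun M s h => by
    rw [← hψk M (N s) s h, add_comm, hψk (N s) M s (hN s)]
  -- Conjugation by `Xᴹ` undoes the shift of the parameter by `M w_i`.
  have hTX : ∀ M i a v, X.symm^[M] (T i (a + M * w i) v) = T i a (X.symm^[M] v) := by
    intro M i a v
    induction M generalizing a v with
    | zero => simp
    | succ M ih =>
      have h := hX i (a + M * w i) (X.symm v)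
      rw [Equiv.apply_symm_apply] at h
      have e : a + ((M + 1 : ℕ) : ℤ) * w i = a + M * w i + w i := by push_cast; ring
      rw [Function.iterate_succ_apply, e, h, Equiv.symm_apply_apply, ih, Function.iterate_succ_apply]
  refine ⟨fun s => ψ (N s) s, ?_, fun s i => ?_, fun s => ?_⟩
  · dsimp only
    rw [hψN 0 0 (by simp)]
    simpa [hψ, ← Pi.zero_def] using h0
  · dsimp only
    have hpos : ∀ j, (0 : ℤ) ≤ (Pi.single i 1 : Fin n → ℤ) j := fun j => by
      by_cases hj : j = i
      · subst hj; simp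
      · simp [hj]
    rw [hψN (N s) (s + Pi.single i 1) fun j => by
      have := hN s j
      have := hpos j
      rw [Pi.add_apply]
      linarith]
    have : (fun j => ((s + Pi.single i 1 : Fin n → ℤ) j + N s * w j).toNat) =
        (fun j => (s j + N s * w j).toNat) + Pi.single i 1 := by
      funext j
      have := hN s j
      by_cases hj : j = i
      · subst hj
        simp only [Pi.add_apply, Pi.single_eq_same]
        rw [add_right_comm]
        omega
      · simp [hj]
    simp only [hψ, this, hφ, ← hTX]
    rw [Int.toNat_of_nonneg (hN s i)]
  · dsimp only
    rw [hψN (N s) (s + fun i => (w i : ℤ)) fun j => by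
      have := hN s j
      rw [Pi.add_apply]
      have : (0 : ℤ) ≤ w j := by positivity
      linarith]
    have e := hψk (N s) 1 s (hN s)
    rw [← e]
    have : (fun j => ((s + fun i => (w i : ℤ)) j + N s * w j).toNat) =
        fun i => (s i + (N s + 1 : ℕ) * w i).toNat := by
      funext j
      rw [Pi.add_apply]
      push_cast
      ring_nf
    simp only [hψ, this, Function.iterate_succ_apply', Equiv.apply_symm_apply]

/-! ## The model of the Brieskorn lattice -/

/-- `x` in `ℂ[x, x⁻¹, θ, θ⁻¹]` or in `ℂ[x, x⁻¹, θ]`. -/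
noncomputable def xPow (Θ : Type) [AddCommMonoid Θ] (k : ℤ) : BaseRing Θ :=
  AddMonoidAlgebra.single (k, 0) 1

theorem xPow_zero (Θ : Type) [AddCommMonoid Θ] : xPow Θ 0 = 1 := rfl

theorem xPow_add (Θ : Type) [AddCommMonoid Θ] (k l : ℤ) :
    xPow Θ (k + l) = xPow Θ k * xPow Θ l := by
  simp [xPow, AddMonoidAlgebra.single_mul_single]

/-- The derivation `x ∂/∂x` of the base ring. -/
noncomputable def baseDer (Θ : Type) [AddCommMonoid Θ] : BaseRing Θ →ₗ[ℂ] BaseRing Θ :=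
  eulerDer
    { toFun := fun e => (e.1 : ℂ)
      map_zero' := by simp
      map_add' := fun e e' => by simp }

theorem baseDer_mul {Θ : Type} [AddCommMonoid Θ] (f g : BaseRing Θ) :
    baseDer Θ (f * g) = baseDer Θ f * g + f * baseDer Θ g := eulerDer_mul _ f g

theorem baseDer_single {Θ : Type} [AddCommMonoid Θ] (e : ℤ × Θ) (c : ℂ) :
    baseDer Θ (AddMonoidAlgebra.single e c) = AddMonoidAlgebra.single e ((e.1 : ℂ) * c) :=
  eulerDer_single _ e c

theorem baseDer_xPow {Θ : Type} [AddCommMonoid Θ] (k : ℤ) :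
    baseDer Θ (xPow Θ k) = (k : BaseRing Θ) * xPow Θ k := by
  rw [xPow, baseDer_single, ← zsmul_eq_mul (AddMonoidAlgebra.single _ _),
    AddMonoidAlgebra.smul_single, zsmul_eq_mul]

theorem baseDer_theta {Θ : Type} [AddCommMonoidWithOne Θ] : baseDer Θ (theta Θ) = 0 := by
  rw [theta, baseDer_single]
  simp

theorem baseDer_one {Θ : Type} [AddCommMonoid Θ] : baseDer Θ 1 = 0 := by
  rw [AddMonoidAlgebra.one_def, baseDer_single]
  simp

theorem baseDer_intCast {Θ : Type} [AddCommMonoid Θ] (k : ℤ) : baseDer Θ k = 0 := by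
  rw [← zsmul_one, map_zsmul, baseDer_one, smul_zero]

theorem baseDer_natCast {Θ : Type} [AddCommMonoid Θ] (k : ℕ) : baseDer Θ k = 0 := by
  rw [← nsmul_one, map_nsmul, baseDer_one, smul_zero]

/-- `∏ wᵢ^{wᵢ}`. -/
noncomputable def weightPow {n : ℕ} (w : Fin (n + 1) → ℕ) : ℂ := ∏ i, (w i : ℂ) ^ w i

theorem weightPow_ne_zero {n : ℕ} {w : Fin (n + 1) → ℕ} (hw : ∀ i, 0 < w i) :
    weightPow w ≠ 0 :=
  Finset.prod_ne_zero_iff.mpr fun i _ => pow_ne_zero _ (by exact_mod_cast (hw i).ne')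

/-- The matrix of `e_k ↦ e_{k+1}`, where `e_μ = w^{-w} x e_0`. -/
noncomputable def cyclicMatrix (Θ : Type) [AddCommMonoid Θ] {n : ℕ} (w : Fin (n + 1) → ℕ) :
    Matrix (Fin (weightSum w)) (Fin (weightSum w)) (BaseRing Θ) :=
  Matrix.of fun i j =>
    if (i : ℕ) = j + 1 then 1
    else if (i : ℕ) = 0 ∧ (j : ℕ) + 1 = weightSum w then
      AddMonoidAlgebra.single (1, 0) (weightPow w)⁻¹
    else 0

/-- The vector `e_k`, for `0 ≤ k ≤ μ`, where `e_μ = w^{-w} x e_0`. -/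
noncomputable def cyclicVector (Θ : Type) [AddCommMonoid Θ] {n : ℕ} (w : Fin (n + 1) → ℕ) (k : ℕ) :
    Fin (weightSum w) → BaseRing Θ := fun i =>
  if (i : ℕ) = k then 1
  else if (i : ℕ) = 0 ∧ k = weightSum w then AddMonoidAlgebra.single (1, 0) (weightPow w)⁻¹
  else 0

theorem cyclicVector_eq_single (Θ : Type) [AddCommMonoid Θ] {n : ℕ} (w : Fin (n + 1) → ℕ)
    (k : Fin (weightSum w)) : cyclicVector Θ w k = Pi.single k 1 := by
  funext i
  by_cases h : i = k
  · simp [cyclicVector, h]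
  · have h' : (i : ℕ) ≠ k := fun h' => h (Fin.ext h')
    simp [cyclicVector, h, h', k.isLt.ne]

theorem cyclicMatrix_mulVec (Θ : Type) [AddCommMonoid Θ] {n : ℕ} (w : Fin (n + 1) → ℕ) {k : ℕ}
    (hk : k < weightSum w) :
    (cyclicMatrix Θ w).mulVec (cyclicVector Θ w k) = cyclicVector Θ w (k + 1) := by
  have := cyclicVector_eq_single Θ w ⟨k, hk⟩
  dsimp only at this
  rw [this, Matrix.mulVec_single_one]
  rfl

theorem cyclicVector_weightSum_eq (Θ : Type) [AddCommMonoid Θ] {n : ℕ} {w : Fin (n + 1) → ℕ}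
    (hw : ∀ i, 0 < w i) :
    cyclicVector Θ w (weightSum w) =
      (AddMonoidAlgebra.single (1, 0) (weightPow w)⁻¹ : BaseRing Θ) • cyclicVector Θ w 0 := by
  have hμ := succ_le_weightSum hw
  funext i
  rw [Pi.smul_apply]
  by_cases hi : (i : ℕ) = 0
  · have : (0 : ℕ) ≠ weightSum w := by omega
    simp [cyclicVector, hi, this]
  · simp [cyclicVector, hi, i.isLt.ne]

theorem cyclicVector_weightSum (Θ : Type) [AddCommMonoid Θ] {n : ℕ} {w : Fin (n + 1) → ℕ}
    (hw : ∀ i, 0 < w i) :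
    algebraMap ℂ (BaseRing Θ) (weightPow w) • cyclicVector Θ w (weightSum w) =
      xPow Θ 1 • cyclicVector Θ w 0 := by
  rw [cyclicVector_weightSum_eq Θ hw, smul_smul, ← Algebra.smul_def, AddMonoidAlgebra.smul_single,
    smul_eq_mul, mul_inv_cancel₀ (weightPow_ne_zero hw), xPow]

/-- The scalar `a(k)ᵢ / wᵢ` at the index `i = i(k)`. -/
noncomputable def ratio (Θ : Type) [AddCommMonoid Θ] {n : ℕ} (w : Fin (n + 1) → ℕ) (k : ℕ) :
    BaseRing Θ := algebraMap ℂ (BaseRing Θ) (minRatio w k : ℂ)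

theorem natCast_mul_ratio (Θ : Type) [AddCommMonoid Θ] {n : ℕ} {w : Fin (n + 1) → ℕ}
    (hw : ∀ i, 0 < w i) (k : ℕ) :
    (w (minIndex w (multiIndex w k)) : BaseRing Θ) * ratio Θ w k =
      (multiIndex w k (minIndex w (multiIndex w k)) : BaseRing Θ) := by
  have hwi : (w (minIndex w (multiIndex w k)) : ℂ) ≠ 0 := by exact_mod_cast (hw _).ne'
  rw [ratio, ← map_natCast (algebraMap ℂ (BaseRing Θ)), ← map_mul,
    ← map_natCast (algebraMap ℂ (BaseRing Θ)), minRatio]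
  congr 1
  push_cast
  field_simp

/-- The operator induced by `x u₀ - θ x ∂/∂x` on the model. -/
noncomputable def modelDelta (Θ : Type) [AddCommMonoidWithOne Θ] {n : ℕ} (w : Fin (n + 1) → ℕ)
    (v : Fin (weightSum w) → BaseRing Θ) : Fin (weightSum w) → BaseRing Θ :=
  (cyclicMatrix Θ w).mulVec v - theta Θ • ((fun i : Fin (weightSum w) => ratio Θ w i) * v) -
    theta Θ • fun i => baseDer Θ (v i)

section modelDelta

variable {Θ : Type} [AddCommMonoidWithOne Θ] {n : ℕ} {w : Fin (n + 1) → ℕ}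

theorem modelDelta_add (v v' : Fin (weightSum w) → BaseRing Θ) :
    modelDelta Θ w (v + v') = modelDelta Θ w v + modelDelta Θ w v' := by
  have h : (fun i => baseDer Θ ((v + v') i)) =
      (fun i => baseDer Θ (v i)) + fun i => baseDer Θ (v' i) := by
    funext i; simp
  rw [modelDelta, modelDelta, modelDelta, h, Matrix.mulVec_add, mul_add]
  module

/-- A Leibniz rule: the operator is linear only over the kernel of `x ∂/∂x`. -/
theorem modelDelta_smul (f : BaseRing Θ) (v : Fin (weightSum w) → BaseRing Θ) :
    modelDelta Θ w (f • v) = f • modelDelta Θ w v - (theta Θ * baseDer Θ f) • v := by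
  have h : (fun i => baseDer Θ ((f • v) i)) = baseDer Θ f • v + f • fun i => baseDer Θ (v i) := by
    funext i; simp [baseDer_mul]
  rw [modelDelta, modelDelta, h, Matrix.mulVec_smul, mul_smul_comm]
  module

/-- For `k < μ` the entries of `e_k` are constants, so the derivation contributes nothing. The case
`k = μ - 1` is included, with `e_μ = w^{-w} x e_0`. -/
theorem modelDelta_cyclicVector {k : ℕ} (hk : k < weightSum w) :
    modelDelta Θ w (cyclicVector Θ w k) =
      cyclicVector Θ w (k + 1) - (theta Θ * ratio Θ w k) • cyclicVector Θ w k := by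
  have e := cyclicVector_eq_single Θ w ⟨k, hk⟩
  dsimp only at e
  have h1 : (fun i => baseDer Θ (cyclicVector Θ w k i)) = 0 := by
    funext i
    rw [e]
    by_cases hi : i = ⟨k, hk⟩
    · subst hi; simp [baseDer_one]
    · simp [hi]
  have h2 : (fun i : Fin (weightSum w) => ratio Θ w i) * cyclicVector Θ w k =
      ratio Θ w k • cyclicVector Θ w k := by
    funext i
    rw [e]
    by_cases hi : i = ⟨k, hk⟩
    · subst hi; simp
    · simp [hi]
  rw [modelDelta, h1, h2, cyclicMatrix_mulVec Θ w hk]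
  module

/-- The product of `wᵢ^{a(k)ᵢ}`. -/
noncomputable def weightFactor (w : Fin (n + 1) → ℕ) (k : ℕ) : ℂ :=
  ∏ i, (w i : ℂ) ^ multiIndex w k i

theorem weightFactor_succ (w : Fin (n + 1) → ℕ) (k : ℕ) :
    weightFactor w (k + 1) = weightFactor w k * w (minIndex w (multiIndex w k)) := by
  simp only [weightFactor, multiIndex_succ, Pi.add_apply, pow_add, Finset.prod_mul_distrib]
  congr 1
  rw [Finset.prod_eq_single (minIndex w (multiIndex w k))] <;> simp +contextual

theorem weightFactor_ne_zero (hw : ∀ i, 0 < w i) (k : ℕ) : weightFactor w k ≠ 0 :=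
  Finset.prod_ne_zero_iff.mpr fun i _ => pow_ne_zero _ (by exact_mod_cast (hw i).ne')

theorem weightFactor_zero (w : Fin (n + 1) → ℕ) : weightFactor w 0 = 1 := by
  simp [weightFactor, multiIndex]

theorem weightFactor_weightSum (hw : ∀ i, 0 < w i) :
    weightFactor w (weightSum w) = weightPow w := by
  rw [weightFactor, multiIndex_weightSum hw, weightPow]

/-- Multiplication by `x`. -/
noncomputable def xEquiv (Θ : Type) [AddCommMonoidWithOne Θ] (w : Fin (n + 1) → ℕ) :
    (Fin (weightSum w) → BaseRing Θ) ≃ (Fin (weightSum w) → BaseRing Θ) where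
  toFun v := xPow Θ 1 • v
  invFun v := xPow Θ (-1) • v
  left_inv v := by beta_reduce; rw [smul_smul, ← xPow_add, neg_add_cancel, xPow_zero, one_smul]
  right_inv v := by beta_reduce; rw [smul_smul, ← xPow_add, add_neg_cancel, xPow_zero, one_smul]

/-- A walk `φ` on the lattice `ℤ^{n+1}`: the images of the monomials in the model. -/
theorem exists_model_walk (Θ : Type) [AddCommMonoidWithOne Θ] (hw : ∀ i, 0 < w i) :
    ∃ φ : (Fin (n + 1) → ℤ) → Fin (weightSum w) → BaseRing Θ,
      (∀ s i, φ (s + Pi.single i 1) =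
        (w i : BaseRing Θ) • modelDelta Θ w (φ s) + ((s i : BaseRing Θ) * theta Θ) • φ s) ∧
      (∀ s, φ (s + fun i => (w i : ℤ)) = xPow Θ 1 • φ s) ∧
      ∀ k, k ≤ weightSum w → φ (fun i => multiIndex w k i) =
        algebraMap ℂ (BaseRing Θ) (weightFactor w k) • cyclicVector Θ w k := by
  set T : Fin (n + 1) → ℤ → (Fin (weightSum w) → BaseRing Θ) → Fin (weightSum w) → BaseRing Θ :=
    fun i a v => (w i : BaseRing Θ) • modelDelta Θ w v + ((a : BaseRing Θ) * theta Θ) • v with hT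
  have hθ : ∀ a : ℤ, baseDer Θ ((a : BaseRing Θ) * theta Θ) = 0 := fun a => by
    rw [baseDer_mul, baseDer_intCast, baseDer_theta, zero_mul, mul_zero, add_zero]
  -- At `a(k)` the direction is `i = i(k)`, where `a(k)_i = w_i r_k`; the step is therefore `w_i (Δ
  -- + θ r_k)`, which takes `e_k` to `w_i e_{k+1}`.
  have hpath : ∀ φ : (Fin (n + 1) → ℕ) → Fin (weightSum w) → BaseRing Θ,
      φ 0 = cyclicVector Θ w 0 → (∀ s i, φ (s + Pi.single i 1) = T i (s i) (φ s)) →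
      ∀ k, k ≤ weightSum w → φ (multiIndex w k) =
        algebraMap ℂ (BaseRing Θ) (weightFactor w k) • cyclicVector Θ w k := by
    intro φ h0 hφ k
    induction k with
    | zero => intro _; rw [weightFactor_zero, map_one, one_smul]; exact h0
    | succ k ih =>
      intro hk
      have hder : baseDer Θ (algebraMap ℂ (BaseRing Θ) (weightFactor w k)) = 0 := by
        rw [Algebra.algebraMap_eq_smul_one, map_smul, baseDer_one, smul_zero]
      rw [multiIndex_succ, hφ, ih (by omega), weightFactor_succ, map_mul, map_natCast, hT]
      simp only [modelDelta_smul, hder, mul_zero, zero_smul, sub_zero,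
        modelDelta_cyclicVector (Θ := Θ) (w := w) (k := k) (by omega)]
      have := natCast_mul_ratio Θ hw k
      rw [Int.cast_natCast, ← this]
      module
  -- All steps are polynomials in the one operator `Δ`, with coefficients killed by `x ∂/∂x`.
  have hcomm : ∀ i j, i ≠ j → ∀ a b v, T i a (T j b v) = T j b (T i a v) := by
    intro i j _ a b v
    simp only [hT, modelDelta_add, modelDelta_smul, hθ, baseDer_natCast]
    module
  -- Since `Δ (x v) = x Δ v - θ x v`, moving `x` past a step costs `w_i θ x v`, which the shift of
  -- `a` by `w_i` restores.
  have hshift : ∀ i a v, T i (a + w i) (xEquiv Θ w v) = xEquiv Θ w (T i a v) := by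
    intro i a v
    simp only [hT, xEquiv, Equiv.coe_fn_mk, modelDelta_smul, baseDer_xPow]
    push_cast
    module
  -- The path ends at `a(μ) = w`, and `w^w e_μ = x e_0`.
  have hcyc : ∀ φ : (Fin (n + 1) → ℕ) → Fin (weightSum w) → BaseRing Θ,
      φ 0 = cyclicVector Θ w 0 → (∀ s i, φ (s + Pi.single i 1) = T i (s i) (φ s)) →
      φ w = xEquiv Θ w (cyclicVector Θ w 0) := by
    intro φ h0 hφ
    have h := hpath φ h0 hφ _ le_rfl
    rw [multiIndex_weightSum hw, weightFactor_weightSum hw, cyclicVector_weightSum Θ hw] at h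
    exact h
  obtain ⟨φ, h0, hφ, hx⟩ :=
    exists_int_walk hw T (xEquiv Θ w) hcomm hshift (cyclicVector Θ w 0) hcyc
  refine ⟨φ, hφ, hx, fun k hk => hpath (fun s => φ fun i => s i) ?_ (fun s i => ?_) k hk⟩
  · simpa [← Pi.zero_def] using h0
  · rw [← hφ]
    congr 1
    funext j
    by_cases hj : j = i
    · subst hj; simp
    · simp [hj]

end modelDelta

/-! ## Monomials in `x u₀, u₁, …, uₙ` -/

section monomials

variable {Θ : Type} [AddCommMonoidWithOne Θ] {n : ℕ} {w : Fin (n + 1) → ℕ}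

/-- The monomial `(x u₀)^{s₀} u₁^{s₁} ⋯ uₙ^{sₙ}`. -/
noncomputable def torusMonomial (Θ : Type) [AddCommMonoid Θ] (w : Fin (n + 1) → ℕ)
    (s : Fin (n + 1) → ℤ) : TotalRing n Θ :=
  AddMonoidAlgebra.single (fun i => s i.succ - w i.succ * s 0, s 0, 0) 1

theorem baseRing_single_smul {Θ : Type} [AddCommMonoid Θ] (e : ℤ × Θ) (c : ℂ)
    (f : (Fin n → ℤ) × ℤ × Θ) (d : ℂ) :
    (AddMonoidAlgebra.single e c : BaseRing Θ) • (AddMonoidAlgebra.single f d : TotalRing n Θ) =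
      AddMonoidAlgebra.single (f.1, e + f.2) (c * d) := by
  rw [Algebra.smul_def, TotalRing.algebraMap_single, AddMonoidAlgebra.single_mul_single]
  congr 1
  ext <;> simp

/-- Because `w₀ = 1`, `(x u₀) u₁^{w₁} ⋯ uₙ^{wₙ} = x`, so multiplication by `x` translates exponents
by `w`. -/
theorem xPow_smul_torusMonomial (hw0 : w 0 = 1) (k : ℤ) (s : Fin (n + 1) → ℤ) :
    xPow Θ k • torusMonomial Θ w s = torusMonomial Θ w (s + fun i => k * w i) := by
  rw [xPow, torusMonomial, torusMonomial, baseRing_single_smul, mul_one]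
  congr 1
  ext <;> simp [hw0]
  · ring
  · ring

theorem torusMonomial_weight (hw0 : w 0 = 1) (s : Fin (n + 1) → ℤ) :
    torusMonomial Θ w (s + fun i => (w i : ℤ)) = xPow Θ 1 • torusMonomial Θ w s := by
  simp [xPow_smul_torusMonomial hw0]

theorem xuZero_mul_torusMonomial (s : Fin (n + 1) → ℤ) :
    xuZero Θ w * torusMonomial Θ w s = torusMonomial Θ w (s + Pi.single 0 1) := by
  rw [xuZero, torusMonomial, torusMonomial, AddMonoidAlgebra.single_mul_single, mul_one]
  congr 1
  ext <;> simp
  · ring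
  · ring

theorem uMon_mul_torusMonomial (i : Fin n) (s : Fin (n + 1) → ℤ) :
    uMon Θ i * torusMonomial Θ w s = torusMonomial Θ w (s + Pi.single i.succ 1) := by
  rw [uMon, torusMonomial, torusMonomial, AddMonoidAlgebra.single_mul_single, mul_one]
  congr 1
  ext j
  · by_cases hj : j = i
    · subst hj; simp; ring
    · simp [hj]
  · simp
  · simp

theorem single_eq_smul_torusMonomial (r : Fin n → ℤ) (a : ℤ) (b : Θ) (c : ℂ) :
    (AddMonoidAlgebra.single (r, a, b) c : TotalRing n Θ) =
      (AddMonoidAlgebra.single (a, b) c : BaseRing Θ) • torusMonomial Θ w (Fin.cons 0 r) := by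
  rw [torusMonomial, baseRing_single_smul]
  simp

theorem span_torusMonomial :
    Submodule.span (BaseRing Θ) (Set.range (torusMonomial Θ w)) = ⊤ := by
  refine Submodule.eq_top_iff'.mpr fun f => ?_
  induction f using AddMonoidAlgebra.induction_linear with
  | zero => exact zero_mem _
  | add f g hf hg => exact add_mem hf hg
  | single e c =>
    obtain ⟨r, a, b⟩ := e
    rw [single_eq_smul_torusMonomial (w := w)]
    exact Submodule.smul_mem _ _ (Submodule.subset_span ⟨_, rfl⟩)

theorem xDer_torusMonomial (s : Fin (n + 1) → ℤ) :
    xDer n Θ (torusMonomial Θ w s) = (s 0 : BaseRing Θ) • torusMonomial Θ w s := by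
  rw [torusMonomial, xDer, eulerDer_single, Int.cast_smul_eq_zsmul, AddMonoidAlgebra.smul_single]
  simp

theorem uDer_torusMonomial (i : Fin n) (s : Fin (n + 1) → ℤ) :
    uDer n Θ (Pi.single i 1) (torusMonomial Θ w s) =
      ((s i.succ - w i.succ * s 0 : ℤ) : BaseRing Θ) • torusMonomial Θ w s := by
  rw [torusMonomial, uDer, eulerDer_single, Int.cast_smul_eq_zsmul, AddMonoidAlgebra.smul_single]
  simp [uChar, Pi.single_apply]

theorem uDer_xuZero (i : Fin n) :
    uDer n Θ (Pi.single i 1) (xuZero Θ w) = -((w i.succ : BaseRing Θ) • xuZero Θ w) := by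
  rw [xuZero, uDer, eulerDer_single, Nat.cast_smul_eq_nsmul, AddMonoidAlgebra.smul_single,
    ← AddMonoidAlgebra.single_neg]
  simp [uChar, Pi.single_apply]

theorem uDer_potential (i : Fin n) :
    uDer n Θ (Pi.single i 1) (potential Θ w) =
      uMon Θ i - (w i.succ : BaseRing Θ) • xuZero Θ w := by
  have h : ∀ j, uDer n Θ (Pi.single i 1) (uMon Θ j) = if j = i then uMon Θ i else 0 := by
    intro j
    rw [uMon, uDer, eulerDer_single]
    split_ifs with hj
    · subst hj; simp [uMon, uChar, Pi.single_apply]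
    · simp [uChar, Pi.single_apply, Ne.symm hj]
  rw [potential, map_add, map_sum, uDer_xuZero, Finset.sum_congr rfl fun j _ => h j]
  simp [sub_eq_add_neg]

/-- Modulo relations, `u_i X^s = w_i x u₀ X^s + θ (s_i - w_i s₀) X^s`. Substituting `x u₀ X^s = Δ
X^s + θ s₀ X^s` turns this into the step `w_i Δ + θ s_i` of the model. -/
theorem twistedDer_torusMonomial (i : Fin n) (s : Fin (n + 1) → ℤ) :
    twistedDer w (theta Θ) 1 (Pi.single i 1) (torusMonomial Θ w s) =
      (theta Θ * ((s i.succ - w i.succ * s 0 : ℤ) : BaseRing Θ)) • torusMonomial Θ w s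
        - torusMonomial Θ w (s + Pi.single i.succ 1)
        + (w i.succ : BaseRing Θ) • torusMonomial Θ w (s + Pi.single 0 1) := by
  simp only [twistedDer, LinearMap.coe_mk, AddHom.coe_mk, uDer_torusMonomial, uDer_potential,
    sub_mul, smul_mul_assoc, uMon_mul_torusMonomial, xuZero_mul_torusMonomial]
  module

/-- The operator `x u₀ - θ x ∂/∂x`. -/
noncomputable def xuDelta (w : Fin (n + 1) → ℕ) (f : TotalRing n Θ) : TotalRing n Θ :=
  xuZero Θ w * f - theta Θ • xDer n Θ f

theorem xuDelta_add (f g : TotalRing n Θ) :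
    xuDelta w (f + g) = xuDelta w f + xuDelta w g := by
  simp only [xuDelta, map_add, mul_add]
  module

theorem xDer_algebraMap (f : BaseRing Θ) :
    xDer n Θ (algebraMap (BaseRing Θ) (TotalRing n Θ) f) =
      algebraMap (BaseRing Θ) (TotalRing n Θ) (baseDer Θ f) := by
  induction f using AddMonoidAlgebra.induction_linear with
  | zero => simp
  | add f g hf hg => simp only [map_add, hf, hg]
  | single e c =>
    rw [TotalRing.algebraMap_single, baseDer_single, TotalRing.algebraMap_single, xDer,
      eulerDer_single]
    rfl

theorem xDer_smul (f : BaseRing Θ) (g : TotalRing n Θ) :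
    xDer n Θ (f • g) = baseDer Θ f • g + f • xDer n Θ g := by
  have := eulerDer_mul (S := (Fin n → ℤ) × ℤ × Θ)
  rw [Algebra.smul_def, xDer, this, ← xDer, xDer_algebraMap, ← Algebra.smul_def,
    ← Algebra.smul_def]

theorem xuDelta_smul (f : BaseRing Θ) (g : TotalRing n Θ) :
    xuDelta w (f • g) = f • xuDelta w g - (theta Θ * baseDer Θ f) • g := by
  simp only [xuDelta, xDer_smul, mul_smul_comm]
  module

theorem xuDelta_torusMonomial (s : Fin (n + 1) → ℤ) :
    xuDelta w (torusMonomial Θ w s) = torusMonomial Θ w (s + Pi.single 0 1) -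
      (theta Θ * (s 0 : BaseRing Θ)) • torusMonomial Θ w s := by
  rw [xuDelta, xuZero_mul_torusMonomial, xDer_torusMonomial, smul_smul]

theorem uDer_smul_base (v : Fin n → ℂ) (f : BaseRing Θ) (g : TotalRing n Θ) :
    uDer n Θ v (f • g) = f • uDer n Θ v g := by
  have h : uDer n Θ v (algebraMap (BaseRing Θ) (TotalRing n Θ) f) = 0 := by
    induction f using AddMonoidAlgebra.induction_linear with
    | zero => simp
    | add c₁ c₂ h₁ h₂ => simp only [map_add, h₁, h₂, add_zero]
    | single e r =>
      rw [TotalRing.algebraMap_single, uDer, eulerDer_single]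
      simp [uChar]
  rw [uDer] at h
  rw [Algebra.smul_def, Algebra.smul_def, uDer, eulerDer_mul, h, zero_mul, zero_add]

theorem xDer_potential : xDer n Θ (potential Θ w) = xuZero Θ w := by
  simp [potential, uMon, xuZero, xDer, eulerDer_single]

/-- As `x ∂F/∂x = x u₀`, the operator is `-θ ∇_{x∂_x}`, and the connection commutes with the
relative differential. -/
theorem xuDelta_twistedDer (v : Fin n → ℂ) (f : TotalRing n Θ) :
    xuDelta w (twistedDer w (theta Θ) 1 v f) = twistedDer w (theta Θ) 1 v (xuDelta w f) := by
  have h1 : ∀ g, xDer n Θ (uDer n Θ v g) = uDer n Θ v (xDer n Θ g) := fun g => eulerDer_comm _ _ g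
  have L : ∀ g h, xDer n Θ (g * h) = xDer n Θ g * h + g * xDer n Θ h := eulerDer_mul _
  have L' : ∀ g h, uDer n Θ v (g * h) = uDer n Θ v g * h + g * uDer n Θ v h := eulerDer_mul _
  simp only [xuDelta, twistedDer, LinearMap.coe_mk, AddHom.coe_mk, map_sub, L', xDer_smul, L, h1,
    xDer_potential, baseDer_theta, baseDer_one, uDer_smul_base]
  simp only [mul_sub, smul_sub, smul_add, mul_smul_comm, zero_smul, one_smul]
  rw [show xuZero Θ w * (uDer n Θ v (potential Θ w) * f) =
    uDer n Θ v (potential Θ w) * (xuZero Θ w * f) by ring]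
  module

/-- This treats `G₀`, where `(a, b) = (θ, 1)`, and `G`, where `(a, b) = (1, τ)`, together. -/
theorem twistedDer_eq_smul {a b : BaseRing Θ} (hab : a = b * theta Θ) (v : Fin n → ℂ)
    (f : TotalRing n Θ) :
    twistedDer w a b v f = b • twistedDer w (theta Θ) 1 v f := by
  simp only [twistedDer, LinearMap.coe_mk, AddHom.coe_mk, hab]
  module

/-- The map of the Laurent polynomials to the model. -/
theorem exists_model_map (Θ : Type) [AddCommMonoidWithOne Θ] (hw : ∀ i, 0 < w i) (hw0 : w 0 = 1) :
    ∃ Ψ : TotalRing n Θ →ₗ[BaseRing Θ] (Fin (weightSum w) → BaseRing Θ),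
      (∀ i f, Ψ (twistedDer w (theta Θ) 1 (Pi.single i 1) f) = 0) ∧
      ∀ k : Fin (weightSum w), Ψ (torusMonomial Θ w fun i => multiIndex w k i) =
        algebraMap ℂ (BaseRing Θ) (weightFactor w k) • Pi.single k 1 := by
  obtain ⟨φ, hφ, hx, hk⟩ := exists_model_walk Θ hw
  have hxk : ∀ (k : ℤ) s, φ (s + fun i => k * w i) = xPow Θ k • φ s := by
    intro k
    have hnat : ∀ (k : ℕ) s, φ (s + fun i => (k : ℤ) * w i) = xPow Θ k • φ s := by
      intro k
      induction k with
      | zero => intro s; simp [xPow_zero, ← Pi.zero_def]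
      | succ k ih =>
        intro s
        have : (s + fun i => ((k + 1 : ℕ) : ℤ) * w i) =
            (s + fun i => (k : ℤ) * w i) + fun i => (w i : ℤ) := by
          funext i; simp; ring
        rw [this, hx, ih, smul_smul, ← xPow_add]
        congr 2
        push_cast
        ring
    intro s
    obtain ⟨k, rfl | rfl⟩ := k.eq_nat_or_neg
    · exact hnat k s
    · have h := hnat k (s + fun i => (-(k : ℤ)) * w i)
      have e : (s + (fun i => (-(k : ℤ)) * w i) + fun i => (k : ℤ) * w i) = s := by
        funext i; simp
      rw [e] at h
      rw [h, smul_smul, ← xPow_add, neg_add_cancel, xPow_zero, one_smul]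
  -- Each Laurent monomial is represented by the exponent with `s₀ = 0`, its power of `x` going to
  -- the base ring.
  let Ψ₀ : TotalRing n Θ →+ (Fin (weightSum w) → BaseRing Θ) :=
    { toFun := fun f => f.coeff.sum fun e c =>
        (AddMonoidAlgebra.single e.2 c : BaseRing Θ) • φ (Fin.cons 0 e.1)
      map_zero' := by simp
      map_add' := fun f g => by
        rw [AddMonoidAlgebra.coeff_add, Finsupp.sum_add_index'] <;>
          simp [AddMonoidAlgebra.single_add, add_smul] }
  have hΨ₀ : ∀ e c, Ψ₀ (AddMonoidAlgebra.single e c) =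
      (AddMonoidAlgebra.single e.2 c : BaseRing Θ) • φ (Fin.cons 0 e.1) := by
    intro e c
    change (AddMonoidAlgebra.single e c : TotalRing n Θ).coeff.sum (fun e c =>
      (AddMonoidAlgebra.single e.2 c : BaseRing Θ) • φ (Fin.cons 0 e.1)) = _
    simp
  let Ψ : TotalRing n Θ →ₗ[BaseRing Θ] (Fin (weightSum w) → BaseRing Θ) :=
    { Ψ₀ with
      map_smul' := fun g f => by
        change Ψ₀ (g • f) = g • Ψ₀ f
        induction f using AddMonoidAlgebra.induction_linear with
        | zero => simp
        | add f₁ f₂ h₁ h₂ => simp only [smul_add, map_add, h₁, h₂]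
        | single e c =>
          induction g using AddMonoidAlgebra.induction_linear with
          | zero => simp
          | add g₁ g₂ h₁ h₂ => simp only [add_smul, map_add, h₁, h₂]
          | single e' c' =>
            rw [baseRing_single_smul, hΨ₀, hΨ₀, smul_smul, AddMonoidAlgebra.single_mul_single] }
  -- Since `φ (s + k w) = x^k φ s`, the choice of representative does not matter.
  have hΨ : ∀ s, Ψ (torusMonomial Θ w s) = φ s := by
    intro s
    refine (hΨ₀ _ _).trans ?_
    rw [show (AddMonoidAlgebra.single (s 0, (0 : Θ)) (1 : ℂ) : BaseRing Θ) = xPow Θ (s 0) from rfl,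
      ← hxk]
    congr 1
    funext i
    refine Fin.cases ?_ (fun i => ?_) i
    · simp [hw0]
    · simp; ring
  refine ⟨Ψ, fun i f => ?_, fun k => ?_⟩
  -- By the step equations in the directions `i` and `0`, the terms in `Δ` cancel, and so do those
  -- in `θ`.
  · have : Ψ ∘ₗ twistedDer w (theta Θ) 1 (Pi.single i 1) = 0 := by
      refine LinearMap.ext_on_range (span_torusMonomial (Θ := Θ) (w := w)) fun s => ?_
      rw [LinearMap.comp_apply, twistedDer_torusMonomial, map_add, map_sub, map_smul, map_smul, hΨ,
        hΨ, hΨ, hφ, hφ, hw0, LinearMap.zero_apply]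
      push_cast
      module
    exact LinearMap.congr_fun this f
  · rw [hΨ, hk k k.isLt.le, cyclicVector_eq_single]

end monomials

/-! ## The canonical basis -/

section basis

variable {Θ : Type} {m : ℕ} {w : Fin (m + 2) → ℕ}

/-- The vector fields `uᵢ ∂/∂uᵢ`. -/
def logFrame (n : ℕ) : Fin n → Fin n → ℂ := fun i => Pi.single i 1

/-- `f ↦ f (du₁/u₁) ∧ ⋯ ∧ (duₙ/uₙ)` as a linear map. -/
noncomputable def logVolumeHom (n : ℕ) (Θ : Type) [AddCommMonoid Θ] :
    TotalRing n Θ →ₗ[BaseRing Θ] TorusForm n Θ n where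
  toFun := logVolume
  map_add' f g := by ext y : 1; simp [logVolume]
  map_smul' c f := by ext y : 1; simp [logVolume, smul_comm c]

theorem logVolumeHom_apply_basis {n : ℕ} [AddCommMonoid Θ] (f : TotalRing n Θ) :
    logVolumeHom n Θ f (logFrame n) = f := by
  have h : logFrame n = ⇑(Pi.basisFun ℂ (Fin n)) := by
    funext i; simp [logFrame]
  change (Pi.basisFun ℂ (Fin n)).det _ • f = f
  rw [h, Module.Basis.det_self, one_smul]

/-- Top forms have rank one: an alternating map is determined on injective families of basis
vectors, which here are permutations of the frame. -/
theorem torusForm_ext {n : ℕ} [AddCommMonoid Θ] {η η' : TorusForm n Θ n}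
    (h : η (logFrame n) = η' (logFrame n)) : η = η' := by
  refine (Pi.basisFun ℂ (Fin n)).ext_alternating fun v hv => ?_
  obtain ⟨σ, rfl⟩ : ∃ σ : Equiv.Perm (Fin n), v = σ :=
    ⟨Equiv.ofBijective v (Finite.injective_iff_bijective.mp hv), rfl⟩
  have e : (fun i => (Pi.basisFun ℂ (Fin n)) (σ i)) =
      logFrame n ∘ σ := by
    funext i; simp [logFrame]
  rw [e, AlternatingMap.map_perm, AlternatingMap.map_perm, h]

theorem logVolumeHom_surjective {n : ℕ} [AddCommMonoid Θ] :
    Function.Surjective (logVolumeHom n Θ) := fun η =>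
  ⟨η (logFrame n), torusForm_ext (logVolumeHom_apply_basis _)⟩

/-- The form `f (du₁/u₁) ∧ ⋯ ∧ (duₙ/uₙ)` without the factor `duᵢ/uᵢ`. -/
noncomputable def logVolumeOmit [AddCommMonoid Θ] (i : Fin (m + 1)) (f : TotalRing (m + 1) Θ) :
    TorusForm (m + 1) Θ m :=
  (LinearMap.toSpanSingleton ℂ (TotalRing (m + 1) Θ) f).compAlternatingMap
    ((Pi.basisFun ℂ (Fin m)).det.compLinearMap (LinearMap.funLeft ℂ ℂ i.succAbove))

theorem logVolumeOmit_apply [AddCommMonoid Θ] (i j : Fin (m + 1)) (f : TotalRing (m + 1) Θ) :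
    logVolumeOmit i f (j.removeNth (logFrame (m + 1))) = if j = i then f else 0 := by
  have e : logVolumeOmit i f (j.removeNth (logFrame (m + 1))) =
      (Pi.basisFun ℂ (Fin m)).det (fun a b => (Pi.single (j.succAbove a) (1 : ℂ) :
        Fin (m + 1) → ℂ) (i.succAbove b)) • f := rfl
  rw [e]
  split_ifs with h
  · subst h
    have : (fun a b => (Pi.single (j.succAbove a) (1 : ℂ) : Fin (m + 1) → ℂ) (j.succAbove b)) =
        ⇑(Pi.basisFun ℂ (Fin m)) := by
      funext a b
      simp [Pi.single_apply]
    rw [this, Module.Basis.det_self, one_smul]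
  -- For `j ≠ i` the field `u_i ∂/∂u_i` is among the arguments, and its only nonzero coordinate is
  -- the one forgotten.
  · obtain ⟨a, ha⟩ := Fin.exists_succAbove_eq (Ne.symm h)
    rw [AlternatingMap.map_coord_zero _ a, zero_smul]
    funext b
    rw [ha]
    simp [Fin.succAbove_ne]

theorem twistedDiff_apply_logFrame [AddCommMonoid Θ] (a b : BaseRing Θ)
    (η : TorusForm (m + 1) Θ m) :
    twistedDiff w a b m η (logFrame (m + 1)) = ∑ i : Fin (m + 1), (-1) ^ (i : ℕ) •
      twistedDer w a b (Pi.single i 1) (η (i.removeNth (logFrame (m + 1)))) :=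
  twistedDiff_apply w a b m η _

theorem twistedDiff_logVolumeOmit [AddCommMonoid Θ] (a b : BaseRing Θ) (i : Fin (m + 1))
    (f : TotalRing (m + 1) Θ) :
    twistedDiff w a b m (logVolumeOmit i f) =
      (-1) ^ (i : ℕ) • logVolumeHom (m + 1) Θ (twistedDer w a b (Pi.single i 1) f) := by
  apply torusForm_ext
  rw [twistedDiff_apply_logFrame, AlternatingMap.smul_apply, logVolumeHom_apply_basis]
  simp only [logVolumeOmit_apply]
  rw [Finset.sum_eq_single i] <;> simp +contextual

theorem logVolumeHom_twistedDer_mem [AddCommMonoid Θ] (a b : BaseRing Θ) (i : Fin (m + 1))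
    (f : TotalRing (m + 1) Θ) :
    logVolumeHom (m + 1) Θ (twistedDer w a b (Pi.single i 1) f) ∈
      LinearMap.range (twistedDiff w a b m) := by
  refine ⟨(-1) ^ (i : ℕ) • logVolumeOmit i f, ?_⟩
  rw [map_zsmul, twistedDiff_logVolumeOmit, smul_smul, ← mul_pow]
  simp

/-! ### Relations between classes, generation and independence -/

variable [AddCommMonoidWithOne Θ] {a b : BaseRing Θ}

/-- The class of `f (du₁/u₁) ∧ ⋯ ∧ (duₙ/uₙ)` in the quotient by the twisted differential. -/
noncomputable def logClass (w : Fin (m + 2) → ℕ) (a b : BaseRing Θ) :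
    TotalRing (m + 1) Θ →ₗ[BaseRing Θ]
      TorusForm (m + 1) Θ (m + 1) ⧸ LinearMap.range (twistedDiff w a b m) :=
  (LinearMap.range (twistedDiff w a b m)).mkQ ∘ₗ logVolumeHom (m + 1) Θ

theorem logClass_surjective : Function.Surjective (logClass w a b) :=
  (Submodule.mkQ_surjective _).comp logVolumeHom_surjective

theorem logClass_twistedDer (hb : IsUnit b) (hab : a = b * theta Θ) (i : Fin (m + 1))
    (f : TotalRing (m + 1) Θ) :
    logClass w a b (twistedDer w (theta Θ) 1 (Pi.single i 1) f) = 0 := by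
  have h : logClass w a b (twistedDer w a b (Pi.single i 1) f) = 0 :=
    (Submodule.Quotient.mk_eq_zero _).mpr (logVolumeHom_twistedDer_mem a b i f)
  rwa [twistedDer_eq_smul hab, map_smul, hb.smul_eq_zero] at h

/-- For `i = 0` the formula is trivial because `w₀ = 1`; including it makes the relation usable at
`i(k)` and summable over all `i`. -/
theorem logClass_add_single (hb : IsUnit b) (hab : a = b * theta Θ) (hw0 : w 0 = 1)
    (s : Fin (m + 2) → ℤ) (i : Fin (m + 2)) :
    logClass w a b (torusMonomial Θ w (s + Pi.single i 1)) =
      (w i : BaseRing Θ) • logClass w a b (torusMonomial Θ w (s + Pi.single 0 1)) +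
      (theta Θ * ((s i - w i * s 0 : ℤ) : BaseRing Θ)) • logClass w a b (torusMonomial Θ w s) := by
  refine Fin.cases ?_ (fun i => ?_) i
  · simp [hw0]
  · have h := logClass_twistedDer (w := w) hb hab i (torusMonomial Θ w s)
    rw [twistedDer_torusMonomial, map_add, map_sub, map_smul, map_smul] at h
    linear_combination (norm := module) -h

/-- The operator commutes with the twisted derivations, and the Leibniz term coming from `b` is a
multiple of a relation. So `Δ` descends to classes. -/
theorem logClass_xuDelta_eq_zero (hb : IsUnit b) (hab : a = b * theta Θ)
    {f : TotalRing (m + 1) Θ} (hf : logClass w a b f = 0) : logClass w a b (xuDelta w f) = 0 := by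
  obtain ⟨η, hη⟩ := (Submodule.Quotient.mk_eq_zero _).mp hf
  have h := congrArg (fun η => η (logFrame (m + 1))) hη
  simp only [logVolumeHom_apply_basis, twistedDiff_apply_logFrame] at h
  have hsum : xuDelta w f = ∑ i : Fin (m + 1), (-1) ^ (i : ℕ) • b •
      twistedDer w (theta Θ) 1 (Pi.single i 1)
        (xuDelta w (η (i.removeNth (logFrame (m + 1))))) -
      (theta Θ * baseDer Θ b) • ∑ i : Fin (m + 1), (-1) ^ (i : ℕ) •
      twistedDer w (theta Θ) 1 (Pi.single i 1) (η (i.removeNth (logFrame (m + 1)))) := by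
    have hadd : ∀ g, xuDelta w g =
        AddMonoidHom.mk' (xuDelta (Θ := Θ) w) xuDelta_add g := fun _ => rfl
    rw [← h, hadd, map_sum, Finset.smul_sum, ← Finset.sum_sub_distrib]
    refine Finset.sum_congr rfl fun i _ => ?_
    rw [map_zsmul, ← hadd, twistedDer_eq_smul hab, xuDelta_smul, xuDelta_twistedDer, smul_sub,
      smul_comm (theta Θ * baseDer Θ b)]
  rw [hsum, map_sub, map_smul, map_sum, map_sum]
  simp only [map_zsmul, map_smul, logClass_twistedDer hb hab, smul_zero, Finset.sum_const_zero,
    sub_zero]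

theorem intCast_multiIndex_succ (w : Fin (m + 2) → ℕ) (k : ℕ) :
    (fun i => (multiIndex w (k + 1) i : ℤ)) =
      (fun i => (multiIndex w k i : ℤ)) + Pi.single (minIndex w (multiIndex w k)) 1 := by
  funext i
  rw [multiIndex_succ]
  by_cases hi : i = minIndex w (multiIndex w k)
  · subst hi; simp
  · simp [hi]

/-- The classes `ω_k`, for `k ≤ μ`. -/
noncomputable def frame (w : Fin (m + 2) → ℕ) (a b : BaseRing Θ) (k : ℕ) :
    TorusForm (m + 1) Θ (m + 1) ⧸ LinearMap.range (twistedDiff w a b m) :=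
  algebraMap ℂ (BaseRing Θ) (weightFactor w k)⁻¹ •
    logClass w a b (torusMonomial Θ w fun i => multiIndex w k i)

theorem isUnit_algebraMap {c : ℂ} (hc : c ≠ 0) : IsUnit (algebraMap ℂ (BaseRing Θ) c) :=
  (isUnit_iff_ne_zero.mpr hc).map _

theorem weightFactor_smul_frame (hw : ∀ i, 0 < w i) (k : ℕ) :
    algebraMap ℂ (BaseRing Θ) (weightFactor w k) • frame w a b k =
      logClass w a b (torusMonomial Θ w fun i => multiIndex w k i) := by
  rw [frame, smul_smul, ← map_mul, mul_inv_cancel₀ (weightFactor_ne_zero hw k), map_one, one_smul]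

theorem frame_weightSum (hw : ∀ i, 0 < w i) (hw0 : w 0 = 1) :
    frame w a b (weightSum w) =
      (AddMonoidAlgebra.single (1, 0) (weightPow w)⁻¹ : BaseRing Θ) • frame w a b 0 := by
  have h : (fun i => (w i : ℤ)) = 0 + fun i => (w i : ℤ) := (zero_add _).symm
  have h0 : (fun i => (multiIndex w 0 i : ℤ)) = 0 := by funext i; simp [multiIndex]
  rw [frame, frame, multiIndex_weightSum hw, h, torusMonomial_weight hw0, weightFactor_weightSum hw,
    weightFactor_zero, h0, map_smul, smul_smul, inv_one, map_one, one_smul, xPow,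
    ← Algebra.smul_def, AddMonoidAlgebra.smul_single, smul_eq_mul, mul_one]

/-- The step relation at `i = i(k)`, divided by `w_i`: its last coefficient `θ (a(k)_i - w_i
a(k)_0)` equals `w_i θ (r_k - a(k)_0)`. Equivalently, `Δ ω_k = ω_{k+1} - θ r_k ω_k`. -/
theorem frame_delta (hw : ∀ i, 0 < w i) (hb : IsUnit b) (hab : a = b * theta Θ) (hw0 : w 0 = 1)
    (k : ℕ) :
    algebraMap ℂ (BaseRing Θ) (weightFactor w k)⁻¹ •
      logClass w a b (torusMonomial Θ w ((fun i => (multiIndex w k i : ℤ)) + Pi.single 0 1)) =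
    frame w a b (k + 1) +
      (theta Θ * ((multiIndex w k 0 : BaseRing Θ) - ratio Θ w k)) • frame w a b k := by
  set i := minIndex w (multiIndex w k) with hi
  have h := logClass_add_single hb hab hw0 (fun i => (multiIndex w k i : ℤ)) i
  rw [hi, ← intCast_multiIndex_succ, ← weightFactor_smul_frame hw (k + 1), weightFactor_succ,
    ← hi] at h
  have hr := natCast_mul_ratio Θ hw k
  rw [← hi] at hr
  have hu : IsUnit (algebraMap ℂ (BaseRing Θ) (weightFactor w k * w i)) :=
    isUnit_algebraMap (mul_ne_zero (weightFactor_ne_zero hw k) (by exact_mod_cast (hw i).ne'))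
  apply hu.smul_left_cancel.mp
  have e : algebraMap ℂ (BaseRing Θ) (weightFactor w k * w i) *
      algebraMap ℂ (BaseRing Θ) (weightFactor w k)⁻¹ = (w i : BaseRing Θ) := by
    rw [← map_mul, mul_right_comm, mul_inv_cancel₀ (weightFactor_ne_zero hw k), one_mul,
      map_natCast]
  have hf := weightFactor_smul_frame (a := a) (b := b) hw k
  rw [smul_smul, e, smul_add, h, map_mul, map_natCast]
  rw [← hf]
  push_cast
  rw [← hr]
  module

/-- The span contains the class of `X^0` and is stable under `Δ`, as `ω_μ` is a multiple of `ω_0`.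
It is then stable under all lattice steps and under division by `x`, which reach every monomial. -/
theorem span_frame (hw : ∀ i, 0 < w i) (hb : IsUnit b) (hab : a = b * theta Θ) (hw0 : w 0 = 1) :
    Submodule.span (BaseRing Θ) (Set.range fun k : Fin (weightSum w) => frame w a b k) = ⊤ := by
  set W := Submodule.span (BaseRing Θ)
    (Set.range fun k : Fin (weightSum w) => frame w a b k) with hW
  have hframe : ∀ k, k ≤ weightSum w → frame w a b k ∈ W := by
    intro k hk
    have hlt : ∀ k, k < weightSum w → frame w a b k ∈ W := fun k hk =>
      Submodule.subset_span ⟨⟨k, hk⟩, rfl⟩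
    rcases hk.lt_or_eq with h | rfl
    · exact hlt k h
    · rw [frame_weightSum hw hw0]
      have := succ_le_weightSum hw
      exact Submodule.smul_mem _ _ (hlt 0 (by omega))
  -- `Δ` is not linear over the base ring, so a lift `g` of each element of `W` is built together
  -- with the fact that `Δ g` lands in `W`; two lifts differ by an element of the kernel, which `Δ`
  -- preserves.
  have hdelta : ∀ f, logClass w a b f ∈ W → logClass w a b (xuDelta w f) ∈ W := by
    have hlift : ∀ y ∈ W, ∃ g, logClass w a b g = y ∧ logClass w a b (xuDelta w g) ∈ W := by
      intro y hy
      induction hy using Submodule.span_induction with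
      | mem y hy =>
        obtain ⟨k, rfl⟩ := hy
        refine ⟨algebraMap ℂ (BaseRing Θ) (weightFactor w k)⁻¹ •
          torusMonomial Θ w fun i => multiIndex w k i, map_smul _ _ _, ?_⟩
        rw [xuDelta_smul, xuDelta_torusMonomial, smul_sub, map_sub, map_sub, map_smul, map_smul,
          map_smul, map_smul, frame_delta hw hb hab hw0, ← weightFactor_smul_frame hw]
        exact sub_mem (sub_mem (add_mem (hframe _ k.isLt)
          (Submodule.smul_mem _ _ (hframe _ k.isLt.le)))
          (Submodule.smul_mem _ _ (Submodule.smul_mem _ _ (Submodule.smul_mem _ _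
            (hframe _ k.isLt.le)))))
          (Submodule.smul_mem _ _ (Submodule.smul_mem _ _ (hframe _ k.isLt.le)))
      | zero => exact ⟨0, map_zero _, by simp [xuDelta]⟩
      | add y y' _ _ h h' =>
        obtain ⟨g, rfl, hg⟩ := h
        obtain ⟨g', rfl, hg'⟩ := h'
        exact ⟨g + g', map_add _ _ _, by rw [xuDelta_add, map_add]; exact add_mem hg hg'⟩
      | smul c y hy h =>
        obtain ⟨g, rfl, hg⟩ := h
        refine ⟨c • g, map_smul _ _ _, ?_⟩
        rw [xuDelta_smul, map_sub, map_smul, map_smul]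
        exact sub_mem (Submodule.smul_mem _ _ hg) (Submodule.smul_mem _ _ hy)
    intro f hf
    obtain ⟨g, hg, hg'⟩ := hlift _ hf
    have h := logClass_xuDelta_eq_zero (w := w) hb hab (f := f - g) (by rw [map_sub, hg, sub_self])
    have e : xuDelta w f = xuDelta w (f - g) + xuDelta w g := by rw [← xuDelta_add, sub_add_cancel]
    rwa [e, map_add, h, zero_add]
  have hmon : ∀ s, logClass w a b (torusMonomial Θ w s) ∈ W := by
    refine int_lattice_induction hw ?_ (fun s i hs => ?_) fun s hs => ?_
    · have h := weightFactor_smul_frame (a := a) (b := b) hw 0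
      have h0 : (fun i => (multiIndex w 0 i : ℤ)) = 0 := by funext i; simp [multiIndex]
      rw [h0] at h
      rw [← h]
      exact Submodule.smul_mem _ _ (hframe 0 (Nat.zero_le _))
    -- As `X^{s + 1_0} = Δ X^s + θ s₀ X^s`, stability under `Δ` settles every direction.
    · rw [logClass_add_single hb hab hw0]
      refine add_mem (Submodule.smul_mem _ _ ?_) (Submodule.smul_mem _ _ hs)
      have h := hdelta _ hs
      rw [xuDelta_torusMonomial, map_sub, map_smul] at h
      exact (Submodule.sub_mem_iff_left _ (Submodule.smul_mem _ _ hs)).mp h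
    · rw [torusMonomial_weight hw0, map_smul] at hs
      have h := Submodule.smul_mem _ (xPow Θ (-1)) hs
      rwa [smul_smul, ← xPow_add, neg_add_cancel, xPow_zero, one_smul] at h
  refine Submodule.eq_top_iff'.mpr fun y => ?_
  obtain ⟨f, rfl⟩ := logClass_surjective y
  have hf : f ∈ Submodule.span (BaseRing Θ) (Set.range (torusMonomial Θ w)) := by
    rw [span_torusMonomial]; trivial
  have hle : Submodule.span (BaseRing Θ) (Set.range (torusMonomial Θ w)) ≤
      W.comap (logClass w a b) := by
    rw [Submodule.span_le]
    rintro _ ⟨s, rfl⟩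
    exact hmon s
  exact hle hf

/-- The model map, applied to the coefficient of a top form, kills the relations and takes this
family to the standard basis. -/
theorem linearIndependent_frame (hw : ∀ i, 0 < w i) (hab : a = b * theta Θ) (hw0 : w 0 = 1) :
    LinearIndependent (BaseRing Θ) fun k : Fin (weightSum w) => frame w a b k := by
  obtain ⟨Ψ, hΨ, hk⟩ := exists_model_map Θ hw hw0
  let Ψ' : TorusForm (m + 1) Θ (m + 1) →ₗ[BaseRing Θ] (Fin (weightSum w) → BaseRing Θ) :=
    { toFun := fun η => Ψ (η (logFrame (m + 1)))
      map_add' := fun η η' => by simp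
      map_smul' := fun c η => by simp }
  have hle : LinearMap.range (twistedDiff w a b m) ≤ LinearMap.ker Ψ' := by
    rintro _ ⟨η, rfl⟩
    rw [LinearMap.mem_ker]
    change Ψ (twistedDiff w a b m η (logFrame (m + 1))) = 0
    rw [twistedDiff_apply_logFrame, map_sum]
    refine Finset.sum_eq_zero fun i _ => ?_
    rw [map_zsmul, twistedDer_eq_smul hab, map_smul, hΨ, smul_zero, smul_zero]
  refine LinearIndependent.of_comp ((LinearMap.range (twistedDiff w a b m)).liftQ Ψ' hle) ?_
  have e : (LinearMap.range (twistedDiff w a b m)).liftQ Ψ' hle ∘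
      (fun k : Fin (weightSum w) => frame w a b k) = fun k => Pi.single k 1 := by
    funext k
    rw [Function.comp_apply, frame, map_smul]
    change _ • Ψ (logVolumeHom (m + 1) Θ _ _) = _
    rw [logVolumeHom_apply_basis, hk, smul_smul, ← map_mul,
      inv_mul_cancel₀ (weightFactor_ne_zero hw k), map_one, one_smul]
  rw [e]
  exact Pi.linearIndependent_single_one _ _

/-- The basis `ω_0, …, ω_{μ-1}`. -/
noncomputable def frameBasis (hw : ∀ i, 0 < w i) (hb : IsUnit b) (hab : a = b * theta Θ)
    (hw0 : w 0 = 1) : Module.Basis (Fin (weightSum w)) (BaseRing Θ)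
      (TorusForm (m + 1) Θ (m + 1) ⧸ LinearMap.range (twistedDiff w a b m)) :=
  Module.Basis.mk (linearIndependent_frame hw hab hw0) (span_frame hw hb hab hw0).ge

theorem frameBasis_apply (hw : ∀ i, 0 < w i) (hb : IsUnit b) (hab : a = b * theta Θ)
    (hw0 : w 0 = 1) (k : Fin (weightSum w)) :
    frameBasis hw hb hab hw0 k = frame w a b k := by
  simp [frameBasis]

end basis

/-! ## The connection in the canonical basis -/

section connection

variable {m : ℕ} {w : Fin (m + 2) → ℕ}

theorem isUnit_tau : IsUnit tau :=
  IsUnit.of_mul_eq_one (theta ℤ) (by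
    rw [theta, tau, AddMonoidAlgebra.single_mul_single]
    norm_num
    rfl)

theorem tau_mul_theta : tau * theta ℤ = 1 := by
  rw [theta, tau, AddMonoidAlgebra.single_mul_single]
  norm_num
  rfl

theorem xuZero_pow_mul_prod_uMon (Θ : Type) [AddCommMonoidWithOne Θ] (w s : Fin (m + 2) → ℕ) :
    xuZero Θ w ^ s 0 * ∏ i : Fin (m + 1), uMon Θ i ^ s i.succ =
      torusMonomial Θ w fun i => (s i : ℤ) := by
  have h0 : torusMonomial Θ w 0 = 1 := by
    simp only [torusMonomial, Pi.zero_apply, mul_zero, sub_zero]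
    rfl
  have hX : ∀ (k : ℕ) (s : Fin (m + 2) → ℤ), xuZero Θ w ^ k * torusMonomial Θ w s =
      torusMonomial Θ w (s + Pi.single 0 (k : ℤ)) := by
    intro k
    induction k with
    | zero => intro s; simp
    | succ k ih =>
      intro s
      rw [pow_succ, mul_assoc, xuZero_mul_torusMonomial, ih, add_assoc, ← Pi.single_add]
      congr 3
      push_cast
      ring
  have hU : ∀ (i : Fin (m + 1)) (k : ℕ) (s : Fin (m + 2) → ℤ), uMon Θ i ^ k * torusMonomial Θ w s =
      torusMonomial Θ w (s + Pi.single i.succ (k : ℤ)) := by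
    intro i k
    induction k with
    | zero => intro s; simp
    | succ k ih =>
      intro s
      rw [pow_succ, mul_assoc, uMon_mul_torusMonomial, ih, add_assoc, ← Pi.single_add]
      congr 3
      push_cast
      ring
  have hP : ∀ t : Finset (Fin (m + 1)), ∏ i ∈ t, uMon Θ i ^ s i.succ =
      torusMonomial Θ w (∑ i ∈ t, Pi.single i.succ (s i.succ : ℤ)) := by
    intro t
    induction t using Finset.induction_on with
    | empty => simp [h0]
    | insert i t hi ih => 
      rw [Finset.prod_insert hi, Finset.sum_insert hi, ih, hU]
      exact congrArg _ (add_comm _ _)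
  rw [hP, hX]
  congr 1
  exact (add_comm _ _).trans ((Fin.sum_univ_succ fun i : Fin (m + 2) =>
    (Pi.single i (s i : ℤ) : Fin (m + 2) → ℤ)).symm.trans
      (Finset.univ_sum_single fun i => (s i : ℤ)))

theorem prod_succ_eq_weightFactor (hw0 : w 0 = 1) (k : ℕ) :
    (∏ i : Fin (m + 1), (w i.succ : ℂ) ^ multiIndex w k i.succ) = weightFactor w k := by
  have := Fin.prod_univ_succ fun i => (w i : ℂ) ^ multiIndex w k i
  rw [weightFactor, this, hw0]
  simp

theorem omegaPhi_eq_frame (hw0 : w 0 = 1) (k : ℕ) :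
    omegaPhi w k = frame w (theta ℕ) 1 k := by
  rw [omegaPhi, xuZero_pow_mul_prod_uMon ℕ w (multiIndex w k),
    prod_succ_eq_weightFactor hw0, frame, ← map_smul,
    algebraMap_smul]
  rfl

theorem coeffIncl_torusMonomial (s : Fin (m + 2) → ℤ) :
    coeffIncl (m + 1) (torusMonomial ℕ w s) = torusMonomial ℤ w s := by
  rw [torusMonomial, coeffIncl_single]
  rfl

theorem toGaussManin_mkQ_logVolume (f : TotalRing (m + 1) ℕ) :
    toGaussManin w ((brieskornRelations w).mkQ (logVolume f)) =
      logClass w 1 tau (coeffIncl (m + 1) f) := by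
  change (gaussManinRelations w).mkQ
    ((coeffIncl (m + 1)).toLinearMap.compAlternatingMap (logVolume f)) =
      (gaussManinRelations w).mkQ (logVolume (coeffIncl (m + 1) f))
  congr 1
  ext y : 1
  simp [logVolume]

theorem toGaussManin_omegaPhi (hw0 : w 0 = 1) (k : ℕ) :
    toGaussManin w (omegaPhi w k) = frame w 1 tau k := by
  rw [omegaPhi, toGaussManin_mkQ_logVolume, xuZero_pow_mul_prod_uMon ℕ w (multiIndex w k),
    prod_succ_eq_weightFactor hw0,
    map_smul, coeffIncl_torusMonomial, frame, ← map_smul, algebraMap_smul]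

theorem gaussManinLift_logClass (D : TotalRing (m + 1) ℤ →ₗ[ℂ] TotalRing (m + 1) ℤ)
    (hD : ∀ v f, D (twistedDer w 1 tau v f) = twistedDer w 1 tau v (D f))
    (f : TotalRing (m + 1) ℤ) :
    gaussManinLift w D hD (logClass w 1 tau f) = logClass w 1 tau (D f) := by
  change (gaussManinRelations w).mkQ (D.compAlternatingMap (logVolume f)) =
      (gaussManinRelations w).mkQ (logVolume (D f))
  congr 1
  ext y : 1
  simp [logVolume]

theorem xOp_torusMonomial (s : Fin (m + 2) → ℤ) :
    xOp w (torusMonomial ℤ w s) = (xInv * (s 0 : BaseRing ℤ)) • torusMonomial ℤ w s -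
      (tau * xInv) • torusMonomial ℤ w (s + Pi.single 0 1) := by
  change xInv • xDer (m + 1) ℤ (torusMonomial ℤ w s) -
    tau • ((xInv • xDer (m + 1) ℤ (potential ℤ w)) * torusMonomial ℤ w s) = _
  rw [xDer_torusMonomial, xDer_potential, smul_mul_assoc, xuZero_mul_torusMonomial, smul_smul,
    smul_smul]

/-- The monomials contain no `τ`, and `F` is the sum of the `n + 1` coordinates. -/
theorem tauOp_torusMonomial (s : Fin (m + 2) → ℤ) :
    tauOp w (torusMonomial ℤ w s) =
      -∑ i : Fin (m + 2), torusMonomial ℤ w (s + Pi.single i 1) := by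
  have h : tauDer (m + 1) (torusMonomial ℤ w s) = 0 := by
    simp [torusMonomial, tauDer, eulerDer_single]
  simp only [tauOp, LinearMap.coe_mk, AddHom.coe_mk, h, potential, add_mul, Finset.sum_mul,
    uMon_mul_torusMonomial, xuZero_mul_torusMonomial, smul_zero, Fin.sum_univ_succ]
  abel

theorem gaussManinLift_frame (D : TotalRing (m + 1) ℤ →ₗ[ℂ] TotalRing (m + 1) ℤ)
    (hD : ∀ v f, D (twistedDer w 1 tau v f) = twistedDer w 1 tau v (D f)) (k : ℕ) :
    gaussManinLift w D hD (frame w 1 tau k) = algebraMap ℂ (BaseRing ℤ) (weightFactor w k)⁻¹ •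
      logClass w 1 tau (D (torusMonomial ℤ w fun i => multiIndex w k i)) := by
  rw [frame, ← map_smul, algebraMap_smul]
  refine (gaussManinLift_logClass D hD _).trans ?_
  rw [map_smul, ← algebraMap_smul (BaseRing ℤ), map_smul]

/-- This is `x ∇_x = -τ Δ` applied to `ω_k`; the terms in `a(k)_0` cancel. -/
theorem nablaX_frame (hw : ∀ i, 0 < w i) (hw0 : w 0 = 1) (k : ℕ) :
    nablaX w (frame w 1 tau k) =
      (xInv * ratio ℤ w k) • frame w 1 tau k - (tau * xInv) • frame w 1 tau (k + 1) := by
  have h := frame_delta hw isUnit_tau tau_mul_theta.symm hw0 k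
  refine (gaussManinLift_frame (xOp w) (xOp_comm w) k).trans ?_
  have e : tau * xInv * (theta ℤ * ((multiIndex w k 0 : BaseRing ℤ) - ratio ℤ w k)) =
      xInv * ((multiIndex w k 0 : BaseRing ℤ) - ratio ℤ w k) := by
    linear_combination (xInv * ((multiIndex w k 0 : BaseRing ℤ) - ratio ℤ w k)) * tau_mul_theta
  rw [xOp_torusMonomial, map_sub, map_smul, map_smul, smul_sub, smul_comm _ (tau * xInv), h,
    smul_comm _ (xInv * _), ← frame, Int.cast_natCast, smul_add, smul_smul, e]
  have key : ∀ (c d : BaseRing ℤ)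
      (y y' : TorusForm (m + 1) ℤ (m + 1) ⧸ LinearMap.range (twistedDiff w 1 tau m)),
      (xInv * c) • y - ((tau * xInv) • y' + (xInv * (c - d)) • y) =
        (xInv * d) • y - (tau * xInv) • y' := by
    intro c d y y'
    module
  exact key _ _ _ _

/-- The step relation summed over `i`, using `∑ w_i = μ` and `∑ a(k)_i = k`. The second sum is the
source of the diagonal matrix `D`. -/
theorem logClass_sum_single (hw0 : w 0 = 1) (k : ℕ) :
    logClass w 1 tau (∑ i : Fin (m + 2),
      torusMonomial ℤ w ((fun i => (multiIndex w k i : ℤ)) + Pi.single i 1)) =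
      (weightSum w : BaseRing ℤ) • logClass w 1 tau
        (torusMonomial ℤ w ((fun i => (multiIndex w k i : ℤ)) + Pi.single 0 1)) +
      (theta ℤ * ((k : BaseRing ℤ) - weightSum w * multiIndex w k 0)) •
        logClass w 1 tau (torusMonomial ℤ w fun i => (multiIndex w k i : ℤ)) := by
  have h1 : ∑ i, (w i : BaseRing ℤ) = weightSum w := by simp [weightSum]
  have h2 : ∑ i, (((multiIndex w k i : ℤ) - w i * (multiIndex w k 0 : ℤ) : ℤ) : BaseRing ℤ) =
      k - weightSum w * multiIndex w k 0 := by
    have h3 : ∑ i, (multiIndex w k i : BaseRing ℤ) = k := by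
      rw [← Nat.cast_sum, sum_multiIndex]
    push_cast
    rw [Finset.sum_sub_distrib, h3, ← Finset.sum_mul, h1]
  rw [map_sum, Finset.sum_congr rfl fun i _ =>
    logClass_add_single isUnit_tau tau_mul_theta.symm hw0 (fun i => (multiIndex w k i : ℤ)) i,
    Finset.sum_add_distrib, ← Finset.sum_smul, ← Finset.sum_smul, ← Finset.mul_sum, h1, h2]

/-- On `ω_k`, multiplication by `F` amounts to `μ Δ + θ k`, and `∇_θ = -τ² ∇_τ` acts on it as `τ²
F`; the terms in `μ a(k)_0` cancel. -/
theorem nablaTheta_frame (hw : ∀ i, 0 < w i) (hw0 : w 0 = 1) (k : ℕ) :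
    nablaTheta w (frame w 1 tau k) =
      (tau ^ 2 * (weightSum w : BaseRing ℤ)) • frame w 1 tau (k + 1) +
      (tau * ((k : BaseRing ℤ) - weightSum w * ratio ℤ w k)) • frame w 1 tau k := by
  have h := frame_delta hw isUnit_tau tau_mul_theta.symm hw0 k
  refine (congrArg (fun y => -(tau ^ 2 • y))
    (gaussManinLift_frame (tauOp w) (tauOp_comm w) k)).trans ?_
  change -(tau ^ 2 • algebraMap ℂ (BaseRing ℤ) (weightFactor w k)⁻¹ •
    logClass w 1 tau (tauOp w (torusMonomial ℤ w fun i => multiIndex w k i))) = _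
  have e : tau ^ 2 * (weightSum w : BaseRing ℤ) *
      (theta ℤ * ((multiIndex w k 0 : BaseRing ℤ) - ratio ℤ w k)) +
      tau ^ 2 * (theta ℤ * ((k : BaseRing ℤ) - weightSum w * multiIndex w k 0)) =
      tau * ((k : BaseRing ℤ) - weightSum w * ratio ℤ w k) := by
    linear_combination (tau * ((k : BaseRing ℤ) - weightSum w * ratio ℤ w k)) * tau_mul_theta
  rw [tauOp_torusMonomial, map_neg, logClass_sum_single hw0, smul_neg, smul_neg, neg_neg, smul_add,
    smul_comm _ (weightSum w : BaseRing ℤ), h, smul_comm _ (theta ℤ * _), ← frame, ← e]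
  module

/-- The case `k = μ` is needed because differentiating `ω_{μ-1}` produces `ω_μ`. -/
theorem frameBasis_repr_frame {Θ : Type} [AddCommMonoidWithOne Θ] {a b : BaseRing Θ}
    (hw : ∀ i, 0 < w i) (hb : IsUnit b) (hab : a = b * theta Θ) (hw0 : w 0 = 1) {k : ℕ}
    (hk : k ≤ weightSum w) (i : Fin (weightSum w)) :
    (frameBasis hw hb hab hw0).repr (frame w a b k) i = cyclicVector Θ w k i := by
  have h : ∀ k : Fin (weightSum w), ∀ i,
      (frameBasis hw hb hab hw0).repr (frame w a b k) i = cyclicVector Θ w k i := by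
    intro k i
    rw [← frameBasis_apply hw hb hab hw0, Module.Basis.repr_self, cyclicVector_eq_single,
      Finsupp.single_eq_pi_single]
  rcases hk.lt_or_eq with hk | rfl
  · exact h ⟨k, hk⟩ i
  · have hμ := succ_le_weightSum hw
    rw [frame_weightSum hw hw0, map_smul, Finsupp.smul_apply, cyclicVector_weightSum_eq Θ hw,
      Pi.smul_apply]
    exact congrArg _ (h ⟨0, by omega⟩ i)

/-- The classes `ω_k` in the Gauss-Manin system. -/
noncomputable def gaussManinFrame (w : Fin (m + 2) → ℕ) (k : ℕ) : GaussManin w :=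
  frame w 1 tau k

/-- The basis `ω_0, …, ω_{μ-1}` of the Gauss-Manin system. -/
noncomputable def gaussManinBasis (hw : ∀ i, 0 < w i) (hw0 : w 0 = 1) :
    Module.Basis (Fin (weightSum w)) (BaseRing ℤ) (GaussManin w) :=
  frameBasis hw isUnit_tau tau_mul_theta.symm hw0

theorem gaussManinBasis_apply (hw : ∀ i, 0 < w i) (hw0 : w 0 = 1) (k : Fin (weightSum w)) :
    gaussManinBasis hw hw0 k = gaussManinFrame w k :=
  frameBasis_apply hw isUnit_tau tau_mul_theta.symm hw0 k

theorem gaussManinBasis_repr_frame (hw : ∀ i, 0 < w i) (hw0 : w 0 = 1) {k : ℕ}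
    (hk : k ≤ weightSum w) (i : Fin (weightSum w)) :
    (gaussManinBasis hw hw0).repr (gaussManinFrame w k) i = cyclicVector ℤ w k i :=
  frameBasis_repr_frame hw isUnit_tau tau_mul_theta.symm hw0 hk i

theorem nablaX_gaussManinFrame (hw : ∀ i, 0 < w i) (hw0 : w 0 = 1) (k : ℕ) :
    nablaX w (gaussManinFrame w k) = (xInv * ratio ℤ w k) • gaussManinFrame w k -
      (tau * xInv) • gaussManinFrame w (k + 1) :=
  nablaX_frame hw hw0 k

theorem nablaTheta_gaussManinFrame (hw : ∀ i, 0 < w i) (hw0 : w 0 = 1) (k : ℕ) :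
    nablaTheta w (gaussManinFrame w k) =
      (tau ^ 2 * (weightSum w : BaseRing ℤ)) • gaussManinFrame w (k + 1) +
      (tau * ((k : BaseRing ℤ) - weightSum w * ratio ℤ w k)) • gaussManinFrame w k :=
  nablaTheta_frame hw hw0 k

/-! ### Evaluation on `ℂ* × ℂ*` and the connection form -/

theorem evalBase_add (p : ℂ × ℂ) (f g : BaseRing ℤ) :
    evalBase p (f + g) = evalBase p f + evalBase p g := by
  rw [evalBase, AddMonoidAlgebra.coeff_add, Finsupp.sum_add_index'] <;> simp [evalBase, add_mul]

theorem evalBase_zero (p : ℂ × ℂ) : evalBase p 0 = 0 := by simp [evalBase]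

theorem evalBase_single (p : ℂ × ℂ) (e : ℤ × ℤ) (c : ℂ) :
    evalBase p (AddMonoidAlgebra.single e c) = c * p.2 ^ e.1 * p.1 ^ e.2 := by
  simp [evalBase]

theorem evalBase_mul {p : ℂ × ℂ} (h1 : p.1 ≠ 0) (h2 : p.2 ≠ 0) (f g : BaseRing ℤ) :
    evalBase p (f * g) = evalBase p f * evalBase p g := by
  induction f using AddMonoidAlgebra.induction_linear with
  | zero => simp [evalBase_zero]
  | add f₁ f₂ e₁ e₂ => simp only [add_mul, evalBase_add, e₁, e₂]
  | single e c =>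
    induction g using AddMonoidAlgebra.induction_linear with
    | zero => simp [evalBase_zero]
    | add g₁ g₂ e₁ e₂ => simp only [mul_add, evalBase_add, e₁, e₂]
    | single e' c' =>
      simp only [AddMonoidAlgebra.single_mul_single, evalBase_single, Prod.fst_add, Prod.snd_add,
        zpow_add₀ h1, zpow_add₀ h2]
      ring

/-- Evaluation at a point of `ℂ* × ℂ*` as a ring homomorphism. -/
noncomputable def evalBaseHom {p : ℂ × ℂ} (h1 : p.1 ≠ 0) (h2 : p.2 ≠ 0) : BaseRing ℤ →+* ℂ where
  toFun := evalBase p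
  map_one' := by rw [AddMonoidAlgebra.one_def, evalBase_single]; simp
  map_zero' := evalBase_zero p
  map_add' := evalBase_add p
  map_mul' := evalBase_mul h1 h2

theorem evalBase_ratio (p : ℂ × ℂ) (k : ℕ) : evalBase p (ratio ℤ w k) = (minRatio w k : ℂ) := by
  rw [ratio]
  refine (evalBase_single p (0, 0) _).trans ?_
  simp

/-- The matrix of `e_k ↦ d e_{k+1}` for `k + 1 < μ`, `e_{μ-1} ↦ c e_0`. -/
def shiftMatrix (μ : ℕ) (d c : ℂ) : Matrix (Fin μ) (Fin μ) ℂ :=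
  Matrix.of fun i j => if (i : ℕ) = j + 1 then d else if (i : ℕ) = 0 ∧ (j : ℕ) + 1 = μ then c else 0

theorem evalBase_cyclicVector (p : ℂ × ℂ) (i j : Fin (weightSum w)) :
    evalBase p (cyclicVector ℤ w (j + 1) i) =
      shiftMatrix (weightSum w) 1 (p.2 * (weightPow w)⁻¹) i j := by
  rw [cyclicVector, shiftMatrix, Matrix.of_apply]
  split_ifs
  · rw [AddMonoidAlgebra.one_def, evalBase_single]; simp
  · rw [evalBase_single]; simp [mul_comm]
  · exact evalBase_zero p

/-- The endomorphism `A - C/θ` appears in both directions, with factor `1/x` along `x` and `-μ/θ`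
along `θ`; the remainder along `θ` is `D/θ`. Only the entry of `C` returning to `ω_0` involves `x`,
so `C = C₀ + x C₁`. -/
theorem connectionForm_gaussManinBasis (hw : ∀ i, 0 < w i) (hw0 : w 0 = 1) (z t : ℂ) (hz : z ≠ 0)
    (ht : t ≠ 0) (X : ℂ × ℂ) :
    connectionForm w (gaussManinBasis hw hw0) (z, t) X =
      modelConnection (weightSum w : ℂ)
        (Matrix.toLin' (shiftMatrix (weightSum w) 1 0))
        (Matrix.toLin' (shiftMatrix (weightSum w) 0 (weightPow w)⁻¹))
        (Matrix.toLin' (Matrix.diagonal fun k : Fin (weightSum w) => (minRatio w k : ℂ)))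
        (Matrix.toLin' (Matrix.diagonal fun k : Fin (weightSum w) => ((k : ℕ) : ℂ))) (z, t) X := by
  have hev : ∀ f, evalBase (z, t) f = evalBaseHom (p := (z, t)) hz ht f := fun _ => rfl
  have hxI : evalBase (z, t) xInv = t⁻¹ := by rw [xInv, evalBase_single]; simp
  have hτ : evalBase (z, t) tau = z⁻¹ := by rw [tau, evalBase_single]; simp
  have hid : ∀ i j : Fin (weightSum w), evalBase (z, t) (cyclicVector ℤ w j i) =
      if i = j then 1 else 0 := by
    intro i j
    rw [cyclicVector_eq_single, Pi.single_apply]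
    split_ifs
    · exact map_one (evalBaseHom (p := (z, t)) hz ht)
    · exact evalBase_zero _
  have hX : ∀ i j : Fin (weightSum w), evalBase (z, t)
      ((gaussManinBasis hw hw0).repr
        (nablaX w (gaussManinBasis hw hw0 j)) i) =
      t⁻¹ * (minRatio w j : ℂ) * (if i = j then 1 else 0) -
        z⁻¹ * t⁻¹ * shiftMatrix (weightSum w) 1 (t * (weightPow w)⁻¹) i j := by
    intro i j
    rw [gaussManinBasis_apply, nablaX_gaussManinFrame hw hw0, map_sub, map_smul, map_smul,
      Finsupp.sub_apply, Finsupp.smul_apply, Finsupp.smul_apply, gaussManinBasis_repr_frame hw hw0 j.isLt.le,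
      gaussManinBasis_repr_frame hw hw0 j.isLt, ← hid, ← evalBase_cyclicVector (z, t), ← hxI, ← hτ,
      ← evalBase_ratio (z, t)]
    simp only [hev, smul_eq_mul, map_sub, map_mul]
  have hθ : ∀ i j : Fin (weightSum w), evalBase (z, t)
      ((gaussManinBasis hw hw0).repr
        (nablaTheta w (gaussManinBasis hw hw0 j)) i) =
      z⁻¹ ^ 2 * weightSum w * shiftMatrix (weightSum w) 1 (t * (weightPow w)⁻¹) i j +
        z⁻¹ * ((j : ℕ) - weightSum w * (minRatio w j : ℂ)) * (if i = j then 1 else 0) := by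
    intro i j
    rw [gaussManinBasis_apply, nablaTheta_gaussManinFrame hw hw0, map_add, map_smul, map_smul,
      Finsupp.add_apply, Finsupp.smul_apply, Finsupp.smul_apply, gaussManinBasis_repr_frame hw hw0 j.isLt.le,
      gaussManinBasis_repr_frame hw hw0 j.isLt, ← hid, ← evalBase_cyclicVector (z, t), ← hτ,
      ← evalBase_ratio (z, t)]
    simp only [hev, smul_eq_mul, map_add, map_sub, map_mul, map_pow, map_natCast]
  have hS : ∀ i j, shiftMatrix (weightSum w) 1 (t * (weightPow w)⁻¹) i j =
      shiftMatrix (weightSum w) 1 0 i j + t * shiftMatrix (weightSum w) 0 (weightPow w)⁻¹ i j := by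
    intro i j
    simp only [shiftMatrix, Matrix.of_apply]
    split_ifs <;> simp
  apply LinearMap.toMatrix'.injective
  ext i j
  simp only [connectionForm, modelConnection, LinearMap.add_apply, LinearMap.smulRight_apply,
    LinearMap.fst_apply, LinearMap.snd_apply, map_add, map_sub, map_smul,
    LinearMap.toMatrix'_toLin', Matrix.add_apply, Matrix.sub_apply, Matrix.smul_apply,
    Matrix.of_apply, hX, hθ, hS, smul_eq_mul, Matrix.diagonal_apply]
  by_cases hij : i = j
  · subst hij
    simp only [if_true]
    ring
  · simp only [hij, if_false]
    ring

end connection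

/-! ## The pairing -/

section pairing

variable {m : ℕ} {w : Fin (m + 2) → ℕ}

/-- The values of a symmetric pairing with two antidiagonal blocks. -/
def blockValue (m μ : ℕ) (c d : ℂ) (k l : ℕ) : ℂ :=
  if k ≤ m + 1 ∧ k + l = m + 1 then c
  else if m + 2 ≤ k ∧ k + l = μ + (m + 1) then d else 0

/-- The Gram matrix with two antidiagonal blocks. -/
def blockMatrix (m μ : ℕ) (c d : ℂ) : Matrix (Fin μ) (Fin μ) ℂ :=
  Matrix.of fun k l => blockValue m μ c d k l

theorem pairingB_eq (w : Fin (m + 2) → ℕ) (z t : ℂ) :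
    pairingB w (z, t) = z ^ (m + 1) •
      (Matrix.toBilin' (blockMatrix m (weightSum w) (∏ i, (w i : ℂ))⁻¹ 0) +
        t • Matrix.toBilin' (blockMatrix m (weightSum w) 0
          ((∏ i, (w i : ℂ) ^ w i) * ∏ i, (w i : ℂ))⁻¹)) := by
  rw [pairingB, ← map_smul, ← map_add, ← map_smul]
  congr 1
  ext k l
  have hz : z ^ ((m : ℤ) + 1) = z ^ (m + 1) := by norm_cast
  simp only [Matrix.of_apply, Matrix.smul_apply, Matrix.add_apply, blockMatrix, blockValue,
    gramMatrix, smul_eq_mul]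
  split_ifs
  · rw [evalBase_single]
    simp only [hz, zpow_zero]
    ring
  · rw [evalBase_single]
    simp only [hz, zpow_one]
    ring
  · rw [evalBase_zero]
    ring

/-! ### Adjoints for the block pairing -/

theorem toBilin'_toLin'_left {μ : ℕ} (M P : Matrix (Fin μ) (Fin μ) ℂ) (v v' : Fin μ → ℂ) :
    Matrix.toBilin' M (Matrix.toLin' P v) v' = Matrix.toBilin' (P.transpose * M) v v' := by
  rw [Matrix.toBilin'_apply', Matrix.toBilin'_apply', Matrix.toLin'_apply, ← Matrix.mulVec_mulVec,
    Matrix.dotProduct_mulVec v, Matrix.vecMul_transpose]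

theorem toBilin'_toLin'_right {μ : ℕ} (M P : Matrix (Fin μ) (Fin μ) ℂ) (v v' : Fin μ → ℂ) :
    Matrix.toBilin' M v (Matrix.toLin' P v') = Matrix.toBilin' (M * P) v v' := by
  rw [Matrix.toBilin'_apply', Matrix.toBilin'_apply', Matrix.toLin'_apply, Matrix.mulVec_mulVec]

/-- The left side multiplies the Gram entry `(k, l)` by `d k + d l`, which matters only where the
entry is nonzero. -/
theorem toBilin'_diagonal_add {μ : ℕ} (M : Matrix (Fin μ) (Fin μ) ℂ) (d : Fin μ → ℂ) (c : ℂ)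
    (h : ∀ k l, M k l ≠ 0 → d k + d l = c) (v v' : Fin μ → ℂ) :
    Matrix.toBilin' M (Matrix.toLin' (Matrix.diagonal d) v) v' +
      Matrix.toBilin' M v (Matrix.toLin' (Matrix.diagonal d) v') = c * Matrix.toBilin' M v v' := by
  have e : (Matrix.diagonal d).transpose * M + M * Matrix.diagonal d = c • M := by
    ext k l
    rw [Matrix.diagonal_transpose, Matrix.add_apply, Matrix.diagonal_mul, Matrix.mul_diagonal,
      Matrix.smul_apply, smul_eq_mul]
    by_cases hM : M k l = 0
    · simp [hM]
    · rw [← h k l hM]; ring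
  rw [toBilin'_toLin'_left, toBilin'_toLin'_right, ← LinearMap.add_apply, ← LinearMap.add_apply,
    ← map_add, e, map_smul]
  rfl

theorem blockValue_comm {m μ : ℕ} (c d : ℂ) {k l : ℕ} (hk : k < μ) (hl : l < μ) :
    blockValue m μ c d k l = blockValue m μ c d l k := by
  unfold blockValue
  split_ifs <;> first | rfl | omega

theorem toBilin'_blockMatrix_comm {m μ : ℕ} (c d : ℂ) (v v' : Fin μ → ℂ) :
    Matrix.toBilin' (blockMatrix m μ c d) v v' = Matrix.toBilin' (blockMatrix m μ c d) v' v := by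
  rw [Matrix.toBilin'_apply, Matrix.toBilin'_apply, Finset.sum_comm]
  refine Finset.sum_congr rfl fun k _ => Finset.sum_congr rfl fun l _ => ?_
  rw [blockMatrix, Matrix.of_apply, Matrix.of_apply, blockValue_comm c d l.isLt k.isLt]
  ring

/-- On each block the matrix is a scalar times a reflection, `k ↦ m + 1 - k` or `k ↦ μ + m + 1 - k`;
these are involutions, so the inverse has the same shape. -/
theorem blockMatrix_mul_inv {m μ : ℕ} (hμ : m + 2 ≤ μ) {c d : ℂ} (hc : c ≠ 0) (hd : d ≠ 0) :
    blockMatrix m μ c d * blockMatrix m μ c⁻¹ d⁻¹ = 1 := by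
  ext k l
  simp only [Matrix.mul_apply, blockMatrix, Matrix.of_apply, Matrix.one_apply]
  by_cases hk : (k : ℕ) ≤ m + 1
  · rw [Finset.sum_eq_single ⟨m + 1 - k, by omega⟩]
    · have h1 : blockValue m μ c d k (m + 1 - k) = c := if_pos ⟨hk, by omega⟩
      by_cases hkl : k = l
      · subst hkl
        have h2 : blockValue m μ c⁻¹ d⁻¹ (m + 1 - k) k = c⁻¹ := if_pos ⟨by omega, by omega⟩
        rw [h1, h2, if_pos rfl, mul_inv_cancel₀ hc]
      · have hkl' : (k : ℕ) ≠ l := fun h => hkl (Fin.ext h)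
        have h2 : blockValue m μ c⁻¹ d⁻¹ (m + 1 - k) l = 0 := by
          unfold blockValue
          rw [if_neg (by omega), if_neg (by omega)]
        rw [if_neg hkl]
        exact mul_eq_zero_of_right _ h2
    · intro j _ hj
      have hj' : (j : ℕ) ≠ m + 1 - k := fun h => hj (Fin.ext h)
      have h1 : blockValue m μ c d k j = 0 := by
        unfold blockValue
        rw [if_neg (by omega), if_neg (by omega)]
      rw [h1, zero_mul]
    · simp
  · rw [Finset.sum_eq_single ⟨μ + (m + 1) - k, by omega⟩]
    · have h1 : blockValue m μ c d k (μ + (m + 1) - k) = d := by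
        unfold blockValue
        rw [if_neg (by omega), if_pos (by omega)]
      by_cases hkl : k = l
      · subst hkl
        have h2 : blockValue m μ c⁻¹ d⁻¹ (μ + (m + 1) - k) k = d⁻¹ := by
          unfold blockValue
          rw [if_neg (by omega), if_pos (by omega)]
        rw [h1, h2, if_pos rfl, mul_inv_cancel₀ hd]
      · have hkl' : (k : ℕ) ≠ l := fun h => hkl (Fin.ext h)
        have h2 : blockValue m μ c⁻¹ d⁻¹ (μ + (m + 1) - k) l = 0 := by
          unfold blockValue
          rw [if_neg (by omega), if_neg (by omega)]
        rw [if_neg hkl]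
        exact mul_eq_zero_of_right _ h2
    · intro j _ hj
      have hj' : (j : ℕ) ≠ μ + (m + 1) - k := fun h => hj (Fin.ext h)
      have h1 : blockValue m μ c d k j = 0 := by
        unfold blockValue
        rw [if_neg (by omega), if_neg (by omega)]
      rw [h1, zero_mul]
    · simp

theorem nondegenerate_blockMatrix {m μ : ℕ} (hμ : m + 2 ≤ μ) {c d : ℂ} (hc : c ≠ 0)
    (hd : d ≠ 0) : (Matrix.toBilin' (blockMatrix m μ c d)).Nondegenerate := by
  refine LinearMap.BilinForm.nondegenerate_toBilin'_of_det_ne_zero' _ ?_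
  exact Matrix.det_ne_zero_of_right_inverse (blockMatrix_mul_inv hμ hc hd)

theorem sum_shiftMatrix_mul {μ : ℕ} (d c : ℂ) (k : Fin μ) (f : ℕ → ℂ) :
    ∑ j : Fin μ, shiftMatrix μ d c j k * f j =
      if (k : ℕ) + 1 < μ then d * f (k + 1) else c * f 0 := by
  have hk := k.isLt
  split_ifs with h
  · rw [Finset.sum_eq_single ⟨k + 1, h⟩]
    · simp [shiftMatrix]
    · intro j _ hj
      have hj' : (j : ℕ) ≠ k + 1 := fun h => hj (Fin.ext h)
      simp [shiftMatrix, hj', h.ne]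
    · simp
  · rw [Finset.sum_eq_single ⟨0, by omega⟩]
    · have h1 : (k : ℕ) + 1 = μ := by omega
      have h2 : 0 ≠ μ := by omega
      simp [shiftMatrix, h1, h2]
    · intro j _ hj
      have hj' : (j : ℕ) ≠ 0 := fun h => hj (Fin.ext h)
      have hj'' : (j : ℕ) ≠ k + 1 := by omega
      simp [shiftMatrix, hj', hj'']
    · simp

/-- Without wrapping, both entries at `(k, l)` test whether `k + l + 1` is `m + 1` or `μ + m + 1`.
With `k = μ - 1` and `l = m + 1 < μ - 1`, one side wraps to `e` times a first-block entry, `e * c`,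
and the other is a second-block entry; this dictates the constant `e * c`. -/
theorem shiftMatrix_adjoint {m μ : ℕ} (hμ : m + 2 ≤ μ) (c e : ℂ) :
    (shiftMatrix μ 1 e).transpose * blockMatrix m μ c (e * c) =
      blockMatrix m μ c (e * c) * shiftMatrix μ 1 e := by
  ext k l
  have h1 := sum_shiftMatrix_mul (1 : ℂ) e k fun j => blockValue m μ c (e * c) j l
  have h2 := sum_shiftMatrix_mul (1 : ℂ) e l fun j => blockValue m μ c (e * c) k j
  rw [Matrix.mul_apply, Matrix.mul_apply]
  simp only [blockMatrix, Matrix.of_apply, Matrix.transpose_apply]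
  rw [h1, Finset.sum_congr rfl fun j _ => mul_comm _ _, h2]
  have hk := k.isLt
  have hl := l.isLt
  unfold blockValue
  split_ifs <;> first | omega | simp

/-- The shift raises the degree given by the diagonal matrix by `1`, and the returning entry lowers
it by `μ - 1`. The disjunctions select one of the two parts, `C₀` or `C₁`. -/
theorem shiftMatrix_commutator {μ : ℕ} (d c : ℂ) (e : ℂ) (hd : d = 0 ∨ e = -1)
    (hc : c = 0 ∨ e = μ - 1) (v : Fin μ → ℂ) :
    Matrix.toLin' (shiftMatrix μ d c)
        (Matrix.toLin' (Matrix.diagonal fun k : Fin μ => ((k : ℕ) : ℂ)) v) -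
      Matrix.toLin' (Matrix.diagonal fun k : Fin μ => ((k : ℕ) : ℂ))
        (Matrix.toLin' (shiftMatrix μ d c) v) = e • Matrix.toLin' (shiftMatrix μ d c) v := by
  rw [← Matrix.toLin'_mul_apply, ← Matrix.toLin'_mul_apply, ← LinearMap.sub_apply, ← map_sub,
    ← LinearMap.smul_apply, ← map_smul]
  congr 2
  ext i j
  rw [Matrix.sub_apply, Matrix.mul_diagonal, Matrix.diagonal_mul, Matrix.smul_apply, smul_eq_mul]
  simp only [shiftMatrix, Matrix.of_apply]
  split_ifs with h1 h2
  · rw [h1]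
    rcases hd with rfl | rfl
    · simp
    · push_cast; ring
  · rw [h2.1]
    rcases hc with rfl | rfl
    · simp
    · have : (μ : ℂ) = (j : ℕ) + 1 := by exact_mod_cast h2.2.symm
      push_cast
      linear_combination (-c) * this
  · simp

end pairing

theorem theorem4p5 (m : ℕ) (w : Fin (m + 2) → ℕ) (hw : ∀ i, 0 < w i) (hw0 : w 0 = 1) :
    ∃ (b₀ : Module.Basis (Fin (weightSum w)) (BaseRing ℕ) (BrieskornLattice w))
      (b : Module.Basis (Fin (weightSum w)) (BaseRing ℤ) (GaussManin w)),
      (∀ k, b₀ k = omegaPhi w k) ∧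
      (∀ k, b k = toGaussManin w (omegaPhi w k)) ∧
      IsSaitoStructure ({0}ᶜ : Set ℂ) (connectionForm w b) (pairingB w) (m + 1) := by
  have hμ := succ_le_weightSum hw
  have hm : (∏ i, (w i : ℂ)) ≠ 0 :=
    Finset.prod_ne_zero_iff.mpr fun i _ => by exact_mod_cast (hw i).ne'
  have hW := weightPow_ne_zero hw
  have hsum : ∀ (c d : ℂ) (t : ℂ), Matrix.toBilin' (blockMatrix m (weightSum w) c 0) +
      t • Matrix.toBilin' (blockMatrix m (weightSum w) 0 d) =
      Matrix.toBilin' (blockMatrix m (weightSum w) c (t * d)) := by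
    intro c d t
    rw [← map_smul, ← map_add]
    congr 1
    ext k l
    simp only [blockMatrix, blockValue, Matrix.add_apply, Matrix.smul_apply, Matrix.of_apply,
      smul_eq_mul]
    split_ifs <;> simp
  have h₀ : ∀ (c : ℂ) (k l : Fin (weightSum w)), blockMatrix m (weightSum w) c 0 k l ≠ 0 →
      (k : ℕ) ≤ m + 1 ∧ (k : ℕ) + l = m + 1 := by
    intro c k l h
    by_contra hne
    simp [blockMatrix, blockValue, hne] at h
  have h₁ : ∀ (d : ℂ) (k l : Fin (weightSum w)), blockMatrix m (weightSum w) 0 d k l ≠ 0 →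
      m + 2 ≤ (k : ℕ) ∧ (k : ℕ) + l = weightSum w + (m + 1) := by
    intro d k l h
    by_contra hne
    simp [blockMatrix, blockValue, hne] at h
  refine ⟨frameBasis hw isUnit_one (one_mul _).symm hw0,
    gaussManinBasis hw hw0, fun k => ?_, fun k => ?_, ?_⟩
  · rw [omegaPhi_eq_frame hw0]
    exact frameBasis_apply hw isUnit_one (one_mul _).symm hw0 k
  · rw [toGaussManin_omegaPhi hw0]
    exact gaussManinBasis_apply hw hw0 k
  · refine IsSaitoStructure.of_modelConnection (Nat.succ_pos m) _ _ _ _ _ _ _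
      (connectionForm_gaussManinBasis hw hw0) (fun z t _ _ => pairingB_eq w z t) ?_ ?_ ?_ ?_
      (toBilin'_blockMatrix_comm _ _) (toBilin'_blockMatrix_comm _ _) ?_ ?_ ?_ ?_ ?_
    · intro v
      rw [← Matrix.toLin'_mul_apply, ← Matrix.toLin'_mul_apply, Matrix.diagonal_mul_diagonal,
        Matrix.diagonal_mul_diagonal]
      simp only [mul_comm]
    · intro v
      rw [shiftMatrix_commutator 1 0 (-1) (Or.inr rfl) (Or.inl rfl) v, neg_one_smul]
    · exact shiftMatrix_commutator _ _ _ (Or.inl rfl) (Or.inr rfl)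
    · intro t ht
      rw [hsum]
      exact nondegenerate_blockMatrix hμ (inv_ne_zero hm)
        (mul_ne_zero ht (inv_ne_zero (mul_ne_zero hW hm)))
    · intro t v v'
      have hC : Matrix.toLin' (shiftMatrix (weightSum w) 1 0) +
          t • Matrix.toLin' (shiftMatrix (weightSum w) 0 (weightPow w)⁻¹) =
          Matrix.toLin' (shiftMatrix (weightSum w) 1 (t * (weightPow w)⁻¹)) := by
        rw [← map_smul, ← map_add]
        congr 1
        ext i j
        simp only [shiftMatrix, Matrix.add_apply, Matrix.smul_apply, Matrix.of_apply, smul_eq_mul]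
        split_ifs <;> simp
      -- The constant of the second block is `w^{-w} x` times that of the first, as
      -- `shiftMatrix_adjoint` requires.
      have hd : t * ((∏ i, (w i : ℂ) ^ w i) * ∏ i, (w i : ℂ))⁻¹ =
          t * (weightPow w)⁻¹ * (∏ i, (w i : ℂ))⁻¹ := by
        rw [weightPow, mul_inv, mul_assoc]
      rw [hsum, hC, hd, toBilin'_toLin'_left, toBilin'_toLin'_right, shiftMatrix_adjoint hμ]
    -- On the first block both indices are at most `n`, so both ratios vanish.
    · intro v v'
      rw [toBilin'_diagonal_add _ _ 0 (fun k l h => ?_), zero_mul]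
      obtain ⟨hk, hkl⟩ := h₀ _ k l h
      rw [minRatio_eq_zero w hk, minRatio_eq_zero w (by omega)]
      simp
    -- On the second block `k < μ` and `k + l = μ + n` force `l > n`, so the symmetry of the nonzero
    -- ratios applies.
    · intro v v'
      rw [toBilin'_diagonal_add _ _ 1 (fun k l h => ?_), one_mul]
      obtain ⟨hk, hkl⟩ := h₁ _ k l h
      have := k.isLt
      exact_mod_cast congrArg (fun q : ℚ => (q : ℂ))
        (minRatio_add_minRatio hw hk (by omega) hkl)
    · exact toBilin'_diagonal_add _ _ _ fun k l h => by exact_mod_cast (h₀ _ k l h).2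
    · exact toBilin'_diagonal_add _ _ _ fun k l h => by
        rw [add_comm ((m + 1 : ℕ) : ℂ)]
        exact_mod_cast (h₁ _ k l h).2
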